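/- Let $Y$ be a compact smooth manifold (without boundary), $R>0$, and let $g=dr^2+f(r)^2h_r$ be a generalized warped product metric on $(0,R)\times Y$: $g$ is a smooth Riemannian metric, $f:(0,R)\to(0,\infty)$ is $C^1$, and $(h_r)_{r\in(0,R)}$ is a family of Riemannian metrics on $Y$ depending $C^1$ on $r$. Geodesics $\gamma=(r,y):I\to(0,R)\times Y$, defined on open intervals $I$, are taken with unit speed. Then: 1. Every geodesic is of one of the following types: radial, i.e. $y$ is constant and $\dot r$ is constant equal to $1$ or to $-1$; or winding, i.e. $\dot y(t)\neq 0$ for all $t\in I$. 2. Suppose in addition that $f$ extends to a convex $C^1$ function on $[0,R)$ with $f(0)=0$, and that $-2c\,h_r\le\partial_r h_r\le 2c\,h_r$ for all $r\in(0,R)$, for a constant $c\ge 0$. Let $0<R'\le R$ be so small that $R'c<1$. Then every maximal winding geodesic $\gamma=(r,y):I\to(0,R')\times Y$ of $g$ on $(0,R')\times Y$ satisfies: (a) $t\mapsto r(t)$ is strictly convex on $I$; (b) $\gamma$ has finite length, i.e. $I=(T_-,T_+)$ with $T_\pm\in\mathbb R$; (c) $\gamma$ enters and leaves at $r=R'$,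 i.e. $r(t)\to R'$ as $t\to T_\pm$. 3. In the warped product case, i.e. if $h_r=h$ does not depend on $r$, for every geodesic $(r,y)$ of $g$ the curve $t\mapsto y(t)$ is a time reparametrization of a (constant speed, possibly constant) geodesic of $(Y,h)$: $y=\tilde y\circ\sigma$ on $I$ with $\sigma$ a $C^2$ function on $I$, $\dot\sigma>0$, and $\tilde y$ a geodesic of $(Y,h)$ on the interval $\sigma(I)$. -/

import Mathlib

open Set Filter Topology Manifold
open scoped ContDiff

noncomputable section

section General

variable {F : Type*} [NormedAddCommGroup F] [NormedSpace ℝ F]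
  {H : Type*} [TopologicalSpace H] (I : ModelWithCorners ℝ F H)
  {M : Type*} [TopologicalSpace M] [ChartedSpace H M]

/-- A field of bilinear forms on the tangent spaces of the manifold `M`. -/
abbrev BilinField (I : ModelWithCorners ℝ F H) (M : Type*) [TopologicalSpace M]
    [ChartedSpace H M] : Type _ :=
  ∀ p : M, LinearMap.BilinForm ℝ (TangentSpace I p)

variable {I}

/-- The coordinate expression of the field `g` in the chart around `p`: the pull-back of `g` by the
inverse of the chart, i.e. `g_{ij}(u) = chartForm g p u (e_i) (e_j)`. -/
def chartForm (g : BilinField I M) (p : M) (u v w : F) : ℝ :=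
  g ((extChartAt I p).symm u)
    (mfderiv 𝓘(ℝ, F) I (extChartAt I p).symm u v)
    (mfderiv 𝓘(ℝ, F) I (extChartAt I p).symm u w)

/-- `g` is a smooth Riemannian metric on the open subset `U` of the (finite-dimensional,
boundaryless) manifold `M`: it is symmetric and positive definite at every point of `U`, and its
coefficients in the charts are smooth. -/
structure IsRiemannianMetricOn (g : BilinField I M) (U : Set M) : Prop where
  symm : ∀ p ∈ U, ∀ v w : TangentSpace I p, g p v w = g p w v
  pos : ∀ p ∈ U, ∀ v : TangentSpace I p, v ≠ 0 → 0 < g p v v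
  smooth : ∀ (p : M) (v w : F), ContDiffOn ℝ ∞ (fun u => chartForm g p u v w)
    ((extChartAt I p).target ∩ (extChartAt I p).symm ⁻¹' U)

variable (I) in
/-- The velocity vector of a curve in `M`. -/
def velocity (γ : ℝ → M) (t : ℝ) : TangentSpace I (γ t) :=
  mfderiv 𝓘(ℝ, ℝ) I γ t (1 : ℝ)

/-- The curve `γ`, restricted to the nonempty open interval `J`, is a (constant speed) geodesic of
the Riemannian metric `g` on the open set `U`: it is a `C²` curve in `U` which satisfies the geodesic
equation in every chart. With `c = (c^i)` the coordinate expression of `γ`, the equation reads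
`d/dt (g_{ij}(c) ċ^j) = 1/2 (∂_i g_{jk})(c) ċ^j ċ^k`, that is,
`g_{ij} (c̈^j + Γ^j_{kl} ċ^k ċ^l) = 0`; these are also Hamilton's equations for the lift
`η_i = g_{ij} ċ^j` and the Hamiltonian `1/2 g^{ij} η_i η_j`. -/
structure IsGeodesicOn (g : BilinField I M) (U : Set M) (γ : ℝ → M) (J : Set ℝ) : Prop where
  isOpen : IsOpen J
  ordConnected : J.OrdConnected
  nonempty : J.Nonempty
  contMDiffOn : ContMDiffOn 𝓘(ℝ, ℝ) I 2 γ J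
  mapsTo : MapsTo γ J U
  geodesic_eq : ∀ (p : M), ∀ t ∈ J, γ t ∈ (chartAt H p).source → ∀ w : F,
    HasDerivAt
      (fun s => chartForm g p (extChartAt I p (γ s)) (deriv (fun a => extChartAt I p (γ a)) s) w)
      (1 / 2 * fderiv ℝ
        (fun u => chartForm g p u (deriv (fun a => extChartAt I p (γ a)) t)
          (deriv (fun a => extChartAt I p (γ a)) t))
        (extChartAt I p (γ t)) w)
      t

/-- A geodesic whose velocity has length one. -/
structure IsUnitSpeedGeodesicOn (g : BilinField I M) (U : Set M) (γ : ℝ → M) (J : Set ℝ) : Prop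
    extends IsGeodesicOn g U γ J where
  unit_speed : ∀ t ∈ J, g (γ t) (velocity I γ t) (velocity I γ t) = 1

/-- A geodesic in `U` on `J` is maximal if it does not extend to a geodesic in `U` on a larger
interval. -/
def IsMaximalGeodesicOn (g : BilinField I M) (U : Set M) (γ : ℝ → M) (J : Set ℝ) : Prop :=
  IsGeodesicOn g U γ J ∧
    ∀ (γ' : ℝ → M) (J' : Set ℝ), IsGeodesicOn g U γ' J' → J ⊆ J' → EqOn γ' γ J → J' = J

/-- On the interval `J`, the curve `y` is a time reparametrization of a geodesic of `(M, g)`: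
`y = c ∘ σ` with `c` a geodesic and `σ` a `C²` function with positive derivative mapping `J`
onto the interval of definition of `c`. -/
def IsReparametrizedGeodesic (g : BilinField I M) (y : ℝ → M) (J : Set ℝ) : Prop :=
  ∃ (σ : ℝ → ℝ) (c : ℝ → M), ContDiffOn ℝ 2 σ J ∧ (∀ t ∈ J, 0 < deriv σ t) ∧
    IsGeodesicOn g univ c (σ '' J) ∧ ∀ t ∈ J, y t = c (σ t)

end General

section Warped

variable {E : Type*} [NormedAddCommGroup E] [NormedSpace ℝ E]
  {Y : Type*} [TopologicalSpace Y] [ChartedSpace E Y]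

/-- The differential `dr` of the coordinate `r` on `ℝ × Y`. -/
def diffR (p : ℝ × Y) (v : TangentSpace (𝓘(ℝ, ℝ).prod 𝓘(ℝ, E)) p) : ℝ :=
  mfderiv (𝓘(ℝ, ℝ).prod 𝓘(ℝ, E)) 𝓘(ℝ, ℝ) (Prod.fst : ℝ × Y → ℝ) p v

/-- The differential of the projection `ℝ × Y → Y`. -/
def diffY (p : ℝ × Y) (v : TangentSpace (𝓘(ℝ, ℝ).prod 𝓘(ℝ, E)) p) : TangentSpace 𝓘(ℝ, E) p.2 :=
  mfderiv (𝓘(ℝ, ℝ).prod 𝓘(ℝ, E)) 𝓘(ℝ, E) (Prod.snd : ℝ × Y → Y) p v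

lemma diffR_add (p : ℝ × Y) (v w : TangentSpace (𝓘(ℝ, ℝ).prod 𝓘(ℝ, E)) p) :
    diffR p (v + w) = diffR p v + diffR p w :=
  map_add (mfderiv (𝓘(ℝ, ℝ).prod 𝓘(ℝ, E)) 𝓘(ℝ, ℝ) (Prod.fst : ℝ × Y → ℝ) p) v w

lemma diffR_smul (p : ℝ × Y) (a : ℝ) (v : TangentSpace (𝓘(ℝ, ℝ).prod 𝓘(ℝ, E)) p) :
    diffR p (a • v) = a * diffR p v :=
  map_smul (mfderiv (𝓘(ℝ, ℝ).prod 𝓘(ℝ, E)) 𝓘(ℝ, ℝ) (Prod.fst : ℝ × Y → ℝ) p) a v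

lemma diffY_add (p : ℝ × Y) (v w : TangentSpace (𝓘(ℝ, ℝ).prod 𝓘(ℝ, E)) p) :
    diffY p (v + w) = diffY p v + diffY p w :=
  map_add (mfderiv (𝓘(ℝ, ℝ).prod 𝓘(ℝ, E)) 𝓘(ℝ, E) (Prod.snd : ℝ × Y → Y) p) v w

lemma diffY_smul (p : ℝ × Y) (a : ℝ) (v : TangentSpace (𝓘(ℝ, ℝ).prod 𝓘(ℝ, E)) p) :
    diffY p (a • v) = a • diffY p v :=
  map_smul (mfderiv (𝓘(ℝ, ℝ).prod 𝓘(ℝ, E)) 𝓘(ℝ, E) (Prod.snd : ℝ × Y → Y) p) a v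

/-- The field of bilinear forms `dr² + f(r)² h_r` on `ℝ × Y`. -/
def warpedForm (f : ℝ → ℝ) (h : ℝ → BilinField 𝓘(ℝ, E) Y) :
    BilinField (𝓘(ℝ, ℝ).prod 𝓘(ℝ, E)) (ℝ × Y) := fun p =>
  LinearMap.mk₂ ℝ
    (fun v w => diffR p v * diffR p w + f p.1 ^ 2 * h p.1 p.2 (diffY p v) (diffY p w))
    (fun v v' w => by
      simp only [diffR_add, diffY_add, map_add, LinearMap.add_apply]; ring)
    (fun a v w => by
      simp only [diffR_smul, diffY_smul, map_smul, LinearMap.smul_apply, smul_eq_mul]; ring)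
    (fun v w w' => by
      simp only [diffR_add, diffY_add, map_add]; ring)
    (fun a v w => by
      simp only [diffR_smul, diffY_smul, map_smul, smul_eq_mul]; ring)

/-- The open subset `(0,R) × Y` of `ℝ × Y`. -/
def cylinder (R : ℝ) (Y : Type*) : Set (ℝ × Y) := Ioo 0 R ×ˢ univ

/-- `dr² + f(r)² h_r` is a generalized warped product metric on `(0,R) × Y`. -/
structure IsGenWarpedProduct (R : ℝ) (f : ℝ → ℝ) (h : ℝ → BilinField 𝓘(ℝ, E) Y) : Prop where
  R_pos : 0 < R
  f_pos : ∀ r ∈ Ioo 0 R, 0 < f r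
  f_contDiffOn : ContDiffOn ℝ 1 f (Ioo 0 R)
  h_metric : ∀ r ∈ Ioo 0 R, IsRiemannianMetricOn (h r) univ
  h_contDiffOn : ∀ (y : Y) (v w : TangentSpace 𝓘(ℝ, E) y),
    ContDiffOn ℝ 1 (fun r => h r y v w) (Ioo 0 R)
  metric : IsRiemannianMetricOn (warpedForm f h) (cylinder R Y)

/-- The regularity bound `-2 c h ≤ ∂_r h ≤ 2 c h` on `(0,R) × Y`. -/
def HasRadialDerivBound (R : ℝ) (h : ℝ → BilinField 𝓘(ℝ, E) Y) (c : ℝ) : Prop :=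
  0 ≤ c ∧ ∀ r ∈ Ioo 0 R, ∀ (y : Y) (v : TangentSpace 𝓘(ℝ, E) y),
    |deriv (fun s => h s y v v) r| ≤ 2 * c * h r y v v

/-- The warping function is (extends to) a convex `C¹` function on `[0,R)` vanishing at `0`. -/
structure IsConvexWarping (R : ℝ) (f : ℝ → ℝ) : Prop where
  contDiffOn : ContDiffOn ℝ 1 f (Ico 0 R)
  zero : f 0 = 0
  convex : ConvexOn ℝ (Ico 0 R) f

/-- Radial: `y` is constant, and `ṙ` is constant equal to `1` or to `-1`. -/
def IsRadial (r : ℝ → ℝ) (y : ℝ → Y) (J : Set ℝ) : Prop :=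
  (∃ y₀, ∀ t ∈ J, y t = y₀) ∧ ((∀ t ∈ J, deriv r t = 1) ∨ (∀ t ∈ J, deriv r t = -1))

variable (E) in
/-- Winding: `ẏ` vanishes nowhere. -/
def IsWinding (y : ℝ → Y) (J : Set ℝ) : Prop :=
  ∀ t ∈ J, velocity 𝓘(ℝ, E) y t ≠ 0

end Warped

end

set_option maxSynthPendingDepth 3
set_option linter.unusedSectionVars false

/-! In a chart, geodesics solve the Euler-Lagrange equation of the energy `½ G(ẋ, ẋ)`. For `dr² + f²
h_r` put `S(ρ) = f(ρ)² h_ρ(ẏ, ẏ)` (`sliceSpeedSq`). Unit speed reads `ṙ² + S(r) = 1`. Since the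
coefficient of `dr²` is constant and there are no cross terms, the radial equation is `r̈ = ½ S'(r)`
(`IsGeodesicOn.hasDerivAt_deriv_fst`).

Radial or winding: `q = 1 - ṙ² = S(r)` has derivative `-ṙ S'(r)`, and locally `|S'(r)| ≤ C S(r)`.
Hence `|q'| ≤ C q`, and by a Gronwall argument the zero set of `q` is open as well as closed
(`IsGenWarpedProduct.velocity_eq_zero`).

Maximal winding geodesics: convexity and `f 0 = 0` give `f'/f ≥ 1/r`, and the bound on `∂_r h` costs
at most `c`, so `r̈ ≥ (1/r - c)(1 - ṙ²) > 0`. The rest of the radial analysis (`IsRadialProfile`)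
uses only this inequality. It gives strict convexity of `r`. It gives `(r ṙ)' ≥ 1 - R'c`, which with
`|r ṙ| ≤ R'` bounds the length. Finally, while `r` decreases, the Clairaut-type quantity `(1 - ṙ²)
r² exp(-2cr)` does not decrease, which keeps `r` away from `0`. So at the right end either `r → R'`
or `r` stays in a compact part of `(0, R')`. In the latter case compactness of `Y` confines the
curve to a compact set and the geodesic extends (`IsUnitSpeedGeodesicOn.exists_extension`), against
maximality. The left end follows by time reversal.

Warped products: the `Y`-component of the equation is the Euler-Lagrange equation of `h` with weight
`f(r)²`, and a new time `σ` with `σ' = f(r)⁻²` absorbs the weight (`EulerLagrangeAt.of_weighted`).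
-/

noncomputable section

/-! ### Continuation of solutions of autonomous ODEs. -/

section ODE

variable {V : Type*} [NormedAddCommGroup V] [NormedSpace ℝ V] [CompleteSpace V]

/-- A solution of an autonomous ODE whose velocity is bounded converges at the right end of its
interval of definition. -/
lemma exists_tendsto_of_deriv_bounded {z z' : ℝ → V} {a b C : ℝ} (hab : a < b)
    (hz : ∀ t ∈ Ioo a b, HasDerivAt z (z' t) t) (hC : ∀ t ∈ Ioo a b, ‖z' t‖ ≤ C) :
    ∃ l, Tendsto z (𝓝[<] b) (𝓝 l) := by
  have hC0 : 0 ≤ C := (norm_nonneg _).trans (hC ((a + b) / 2) ⟨by linarith, by linarith⟩)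
  have hlip : LipschitzOnWith ⟨C, hC0⟩ z (Ioo a b) :=
    (convex_Ioo a b).lipschitzOnWith_of_nnnorm_hasDerivWithin_le
      (fun t ht => (hz t ht).hasDerivWithinAt) (fun t ht => hC t ht)
  have hc : Cauchy (map z (𝓝[<] b)) := by
    refine Cauchy.map_of_le ((cauchy_nhds (a := b)).mono inf_le_left)
      hlip.uniformContinuousOn ?_
    exact le_principal_iff.2 (Ioo_mem_nhdsLT hab)
  exact CompleteSpace.complete hc

/-- A solution of an autonomous ODE which stays in a compact set extends. -/
lemma exists_extension_of_mem_compact {X : V → V} {Ω K : Set V} (hΩ : IsOpen Ω)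
    (hX : ContDiffOn ℝ 1 X Ω) (hK : IsCompact K) (hKΩ : K ⊆ Ω) {z : ℝ → V} {a b : ℝ} (hab : a < b)
    (hz : ∀ t ∈ Ioo a b, HasDerivAt z (X (z t)) t) (hzK : ∀ t ∈ Ioo a b, z t ∈ K) :
    ∃ b' > b, ∃ ζ : ℝ → V, (∀ t ∈ Ioo a b', ζ t ∈ Ω ∧ HasDerivAt ζ (X (ζ t)) t) ∧
      ∀ t < b, ζ t = z t := by
  obtain ⟨C, hC⟩ := hK.exists_bound_of_continuousOn (hX.continuousOn.mono hKΩ)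
  obtain ⟨l, hl⟩ := exists_tendsto_of_deriv_bounded hab hz (fun t ht => hC _ (hzK t ht))
  have hev : ∀ᶠ t in 𝓝[<] b, t ∈ Ioo a b := Ioo_mem_nhdsLT hab
  have hlK : l ∈ K := hK.isClosed.mem_of_tendsto hl (hev.mono hzK)
  have hlΩ := hKΩ hlK
  have hXl : ContDiffAt ℝ 1 X l := hX.contDiffAt (hΩ.mem_nhds hlΩ)
  -- Picard-Lindelöf at the limit `l`: the continuation beyond `b` is the solution `α` with `α b =
  -- l`.
  obtain ⟨ρ, hρ, ε, hε, hsol⟩ :=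
    hXl.exists_forall_mem_closedBall_exists_eq_forall_mem_Ioo_hasDerivAt b
  obtain ⟨α, hα0, hα⟩ := hsol l (Metric.mem_closedBall_self hρ.le)
  have hαb : HasDerivAt α (X l) b := by
    have := hα b ⟨by linarith, by linarith⟩
    rwa [hα0] at this
  have hαΩ : ∀ᶠ t in 𝓝 b, α t ∈ Ω :=
    hαb.continuousAt.eventually (by rw [hα0]; exact hΩ.mem_nhds hlΩ)
  obtain ⟨δ, hδ, hαδ⟩ := Metric.eventually_nhds_iff.1 hαΩ
  set ζ : ℝ → V := fun t => if t < b then z t else α t with hζ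
  have hζlt : ∀ t < b, ζ t = z t := fun t ht => if_pos ht
  have hζge : ∀ t, b ≤ t → ζ t = α t := fun t ht => if_neg (not_lt.2 ht)
  have hζb : ζ b = l := by rw [hζge b le_rfl, hα0]
  -- `ε` is the lifetime of `α`; `δ` keeps `α` inside `Ω`.
  refine ⟨b + min ε δ, by simp [hε, hδ], ζ, fun t ht => ?_, hζlt⟩
  rcases lt_trichotomy t b with htb | htb | htb
  · have heq : ζ =ᶠ[𝓝 t] z := by
      filter_upwards [Iio_mem_nhds htb] with s hs using hζlt s hs
    rw [hζlt t htb]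
    exact ⟨hKΩ (hzK t ⟨ht.1, htb⟩), (hz t ⟨ht.1, htb⟩).congr_of_eventuallyEq heq⟩
  · subst htb
    rw [hζb]
    refine ⟨hlΩ, ?_⟩
    -- At the junction the left derivative is the limit of the derivatives `X (z s)`, and the right
    -- one comes from `α`; both equal `X l`.
    have hleft : HasDerivWithinAt ζ (X l) (Iic t) t := by
      refine hasDerivWithinAt_Iic_of_tendsto_deriv (s := Ioo a t) ?_ ?_ (Ioo_mem_nhdsLT hab) ?_
      · intro s hs
        have heq : ζ =ᶠ[𝓝 s] z := by
          filter_upwards [Iio_mem_nhds hs.2] with r hr using hζlt r hr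
        exact ((hz s hs).congr_of_eventuallyEq heq).differentiableAt.differentiableWithinAt
      · rw [ContinuousWithinAt, hζb]
        refine (hl.mono_left (nhdsWithin_mono _ Ioo_subset_Iio_self)).congr' ?_
        filter_upwards [self_mem_nhdsWithin] with s hs using (hζlt s hs.2).symm
      · have : Tendsto (fun s => X (z s)) (𝓝[<] t) (𝓝 (X l)) :=
          hXl.continuousAt.tendsto.comp hl
        refine this.congr' ?_
        filter_upwards [hev] with s hs
        have heq : ζ =ᶠ[𝓝 s] z := by
          filter_upwards [Iio_mem_nhds hs.2] with r hr using hζlt r hr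
        exact ((hz s hs).congr_of_eventuallyEq heq).deriv.symm
    have hright : HasDerivWithinAt ζ (X l) (Ici t) t :=
      hαb.hasDerivWithinAt.congr (fun s hs => hζge s hs) (hζge t le_rfl)
    have := hleft.union hright
    rwa [Iic_union_Ici, hasDerivWithinAt_univ] at this
  · have heq : ζ =ᶠ[𝓝 t] α := by
      filter_upwards [Ioi_mem_nhds htb] with s hs using hζge s (le_of_lt hs)
    rw [hζge t htb.le]
    have h1 := min_le_left ε δ
    have h2 := min_le_right ε δ
    refine ⟨hαδ ?_, (hα t ⟨by linarith, by linarith [ht.2]⟩).congr_of_eventuallyEq heq⟩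
    rw [Real.dist_eq, abs_of_pos (by linarith)]
    linarith [ht.2]

end ODE

/-! ### The Euler-Lagrange equation of the energy in coordinates. -/

section EulerLagrange

variable {F F' : Type*} [NormedAddCommGroup F] [NormedSpace ℝ F] [NormedAddCommGroup F']
  [NormedSpace ℝ F']

/-- The curve `x` satisfies at time `t` the Euler-Lagrange equation of the energy of the field of
bilinear forms `G`. -/
def EulerLagrangeAt (G : F → F →L[ℝ] F →L[ℝ] ℝ) (x : ℝ → F) (t : ℝ) : Prop :=
  ∀ w : F, HasDerivAt (fun s => G (x s) (deriv x s) w)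
    (1 / 2 * fderiv ℝ (fun u => G u (deriv x t) (deriv x t)) (x t) w) t

lemma EulerLagrangeAt.congr {G : F → F →L[ℝ] F →L[ℝ] ℝ} {x x' : ℝ → F} {t : ℝ}
    (h : EulerLagrangeAt G x t) (hx : x' =ᶠ[𝓝 t] x) : EulerLagrangeAt G x' t := by
  intro w
  rw [hx.eq_of_nhds, hx.deriv_eq]
  refine (h w).congr_of_eventuallyEq ?_
  filter_upwards [hx, hx.deriv] with s hs hs'
  rw [hs, hs']

lemma fderiv_form_apply {G : F → F →L[ℝ] F →L[ℝ] ℝ} {z : F} (hG : DifferentiableAt ℝ G z)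
    (a b w : F) : fderiv ℝ (fun u => G u a b) z w = fderiv ℝ G z w a b := by
  have h := (hG.hasFDerivAt.clm_apply (hasFDerivAt_const a z)).clm_apply (hasFDerivAt_const b z)
  rw [h.fderiv]
  simp

/-- Carrying out the time derivative by the product rule turns the equation into a pointwise
algebraic identity in `x`, `ẋ`, `ẍ`. -/
lemma eulerLagrangeAt_iff {G : F → F →L[ℝ] F →L[ℝ] ℝ} {x : ℝ → F} {t : ℝ}
    (hG : DifferentiableAt ℝ G (x t)) (hx : DifferentiableAt ℝ x t)
    (hx' : DifferentiableAt ℝ (deriv x) t) :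
    EulerLagrangeAt G x t ↔ ∀ w,
      fderiv ℝ G (x t) (deriv x t) (deriv x t) w + G (x t) (deriv (deriv x) t) w =
        1 / 2 * fderiv ℝ G (x t) w (deriv x t) (deriv x t) := by
  have h1 : ∀ w, HasDerivAt (fun s => G (x s) (deriv x s) w)
      (fderiv ℝ G (x t) (deriv x t) (deriv x t) w + G (x t) (deriv (deriv x) t) w) t := by
    intro w
    have hA : HasDerivAt (fun s => G (x s)) (fderiv ℝ G (x t) (deriv x t)) t :=
      hG.hasFDerivAt.comp_hasDerivAt t hx.hasDerivAt
    have hB : HasDerivAt (fun s => G (x s) (deriv x s))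
        (fderiv ℝ G (x t) (deriv x t) (deriv x t) + G (x t) (deriv (deriv x) t)) t :=
      hA.clm_apply hx'.hasDerivAt
    have hC := hB.clm_apply (hasDerivAt_const t w)
    rwa [map_zero, add_zero, add_apply] at hC
  refine forall_congr' fun w => ?_
  rw [fderiv_form_apply hG]
  exact ⟨fun h => (h1 w).unique h, fun h => h ▸ h1 w⟩

/-- The Euler-Lagrange equation is invariant under changes of coordinates. -/
lemma EulerLagrangeAt.map {G : F → F →L[ℝ] F →L[ℝ] ℝ} {G' : F' → F' →L[ℝ] F' →L[ℝ] ℝ}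
    {φ : F → F'} {x : ℝ → F} {t : ℝ} (h : EulerLagrangeAt G x t) (hx : ContDiffAt ℝ 2 x t)
    (hφ : ContDiffAt ℝ 2 φ (x t)) (hsurj : Function.Surjective (fderiv ℝ φ (x t)))
    (hG' : DifferentiableAt ℝ G' (φ (x t)))
    (hsymm : ∀ v w, G' (φ (x t)) v w = G' (φ (x t)) w v)
    (hGG' : ∀ᶠ u in 𝓝 (x t), ∀ v w, G u v w = G' (φ u) (fderiv ℝ φ u v) (fderiv ℝ φ u w))
    (hG : DifferentiableAt ℝ G (x t)) :
    EulerLagrangeAt G' (φ ∘ x) t := by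
  have hxd : DifferentiableAt ℝ x t := hx.differentiableAt (by norm_num)
  have hx1 : ContDiffAt ℝ 1 (deriv x) t := ContDiffAt.derivWithin hx (by norm_num)
  have hxd' : DifferentiableAt ℝ (deriv x) t := hx1.differentiableAt (by norm_num)
  have hφ1 : ContDiffAt ℝ 1 (fderiv ℝ φ) (x t) := hφ.fderiv_right (by norm_num)
  have hφd : DifferentiableAt ℝ (fderiv ℝ φ) (x t) := hφ1.differentiableAt (by norm_num)
  have hφd0 : DifferentiableAt ℝ φ (x t) := hφ.differentiableAt (by norm_num)
  have hev : ∀ᶠ s in 𝓝 t, deriv (φ ∘ x) s = fderiv ℝ φ (x s) (deriv x s) := by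
    filter_upwards [hx.eventually (by simp), hxd.continuousAt.eventually (hφ.eventually (by simp))]
      with s hs hs'
    exact fderiv_comp_deriv s (hs'.differentiableAt (by norm_num))
      (hs.differentiableAt (by norm_num))
  have hd1 : deriv (φ ∘ x) t = fderiv ℝ φ (x t) (deriv x t) := hev.self_of_nhds
  have hd2 : HasDerivAt (deriv (φ ∘ x)) (fderiv ℝ (fderiv ℝ φ) (x t) (deriv x t) (deriv x t) +
      fderiv ℝ φ (x t) (deriv (deriv x) t)) t := by
    refine HasDerivAt.congr_of_eventuallyEq ?_ hev
    exact (hφd.hasFDerivAt.comp_hasDerivAt t hxd.hasDerivAt).clm_apply hxd'.hasDerivAt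
  have hDG : ∀ z a b, fderiv ℝ G (x t) z a b =
      fderiv ℝ G' (φ (x t)) (fderiv ℝ φ (x t) z) (fderiv ℝ φ (x t) a) (fderiv ℝ φ (x t) b) +
      G' (φ (x t)) (fderiv ℝ (fderiv ℝ φ) (x t) z a) (fderiv ℝ φ (x t) b) +
      G' (φ (x t)) (fderiv ℝ φ (x t) a) (fderiv ℝ (fderiv ℝ φ) (x t) z b) := by
    -- Differentiate `G = φ^* G'`: besides the pulled-back derivative of `G'`, two terms with the
    -- second derivative of `φ` appear.
    intro z a b
    rw [← fderiv_form_apply hG]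
    have hE : (fun u => G u a b) =ᶠ[𝓝 (x t)]
        fun u => G' (φ u) (fderiv ℝ φ u a) (fderiv ℝ φ u b) := by
      filter_upwards [hGG'] with u hu using hu a b
    rw [hE.fderiv_eq]
    have hA : ∀ a, HasFDerivAt (fun u => fderiv ℝ φ u a) _ (x t) := fun a =>
      hφd.hasFDerivAt.clm_apply (hasFDerivAt_const a (x t))
    have hB : HasFDerivAt (fun u => G' (φ u)) (fderiv ℝ G' (φ (x t)) ∘L fderiv ℝ φ (x t)) (x t) :=
      hG'.hasFDerivAt.comp (x t) hφd0.hasFDerivAt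
    have hC := hB.clm_apply (hA a)
    have hD := hC.clm_apply (hA b)
    rw [hD.fderiv]
    simp
    ring
  have h0 := (eulerLagrangeAt_iff hG hxd hxd').1 h
  refine (eulerLagrangeAt_iff hG' (hφd0.comp t hxd) hd2.differentiableAt).2 fun w' => ?_
  -- Every test vector is the image of one for `G`, so the old equation can be used at its preimage.
  obtain ⟨w, rfl⟩ := hsurj w'
  have h2 := h0 w
  rw [hd2.deriv, hd1, Function.comp_apply]
  rw [hDG, hDG, hGG'.self_of_nhds] at h2
  -- On the right side the two second-derivative terms coincide by symmetry of `G'`; symmetry of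
  -- `D²φ` then matches their half-sum with a term on the left.
  have hs := hφ.isSymmSndFDerivAt (by simp) w (deriv x t)
  rw [hs, hsymm (fderiv ℝ (fderiv ℝ φ) (x t) (deriv x t) w)] at h2
  rw [map_add, add_apply]
  linarith

/-! ### The equation as a first-order system, and its continuation. -/

section Spray

variable [FiniteDimensional ℝ F]

/-- The acceleration prescribed by the Euler-Lagrange equation. -/
def sprayAcc (G : F → F →L[ℝ] F →L[ℝ] ℝ) (x v : F) : F :=
  (G x).inverse ((1 / 2 : ℝ) • ((fderiv ℝ G x).flip v).flip v - fderiv ℝ G x v v)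

/-- Definiteness makes `B` injective into the dual, which has the same dimension. Thus the `inverse`
in `sprayAcc` is a genuine inverse and not its default value `0`. -/
lemma exists_equiv_of_posDef (B : F →L[ℝ] F →L[ℝ] ℝ) (hB : ∀ v, v ≠ 0 → 0 < B v v) :
    ∃ e : F ≃L[ℝ] (F →L[ℝ] ℝ), (e : F →L[ℝ] F →L[ℝ] ℝ) = B := by
  have hinj : Function.Injective (B : F →ₗ[ℝ] F →L[ℝ] ℝ) := by
    rw [← LinearMap.ker_eq_bot, LinearMap.ker_eq_bot']
    intro v hv
    by_contra h
    have h1 : B v = 0 := hv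
    have := hB v h
    rw [h1] at this
    simp at this
  have hr : Module.finrank ℝ F = Module.finrank ℝ (F →L[ℝ] ℝ) := by
    rw [← (LinearMap.toContinuousLinearMap (𝕜 := ℝ) (E := F) (F' := ℝ)).finrank_eq]
    exact (Subspace.dual_finrank_eq (K := ℝ) (V := F)).symm
  refine ⟨(LinearEquiv.ofInjectiveOfFinrankEq _ hinj hr).toContinuousLinearEquiv, ?_⟩
  ext v w
  rfl

lemma form_sprayAcc {G : F → F →L[ℝ] F →L[ℝ] ℝ} {x : F} (hG : ∀ v, v ≠ 0 → 0 < G x v v)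
    (v w : F) :
    G x (sprayAcc G x v) w = 1 / 2 * fderiv ℝ G x w v v - fderiv ℝ G x v v w := by
  obtain ⟨e, he⟩ := exists_equiv_of_posDef (G x) hG
  rw [sprayAcc, ← he, ContinuousLinearMap.inverse_equiv]
  simp

/-- Inversion is smooth near invertible maps; `C¹` is the regularity that Picard-Lindelöf needs. -/
lemma contDiffOn_sprayAcc {G : F → F →L[ℝ] F →L[ℝ] ℝ} {O : Set F} (hO : IsOpen O)
    (hG : ContDiffOn ℝ ∞ G O) (hpos : ∀ x ∈ O, ∀ v, v ≠ 0 → 0 < G x v v) :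
    ContDiffOn ℝ 1 (fun z : F × F => sprayAcc G z.1 z.2) (O ×ˢ univ) := by
  have hG1 : ContDiffOn ℝ 1 (fderiv ℝ G) O := hG.fderiv_of_isOpen hO (by norm_cast)
  have hfst : ContDiffOn ℝ 1 (Prod.fst : F × F → F) (O ×ˢ univ) := contDiff_fst.contDiffOn
  have hsnd : ContDiffOn ℝ 1 (Prod.snd : F × F → F) (O ×ˢ univ) := contDiff_snd.contDiffOn
  have hm : MapsTo (Prod.fst : F × F → F) (O ×ˢ univ) O := fun z hz => hz.1
  have hD := hG1.comp hfst hm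
  have hinv : ContDiffOn ℝ 1 (fun z : F × F => (G z.1).inverse) (O ×ˢ univ) := by
    intro z hz
    obtain ⟨e, he⟩ := exists_equiv_of_posDef (G z.1) (hpos _ hz.1)
    have h1 := contDiffAt_map_inverse (𝕜 := ℝ) (n := 1) e
    rw [he] at h1
    exact h1.comp_contDiffWithinAt z (((hG.of_le (by exact_mod_cast le_top)).comp hfst hm) z hz)
  refine hinv.clm_apply (ContDiffOn.sub (ContDiffOn.const_smul _ ?_) ?_)
  · refine contDiffOn_clm_apply.2 fun w => ?_
    exact ((hD.clm_apply contDiffOn_const).clm_apply hsnd).clm_apply hsnd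
  · exact (hD.clm_apply hsnd).clm_apply hsnd

lemma eulerLagrangeAt_iff_deriv_eq_sprayAcc {G : F → F →L[ℝ] F →L[ℝ] ℝ} {x : ℝ → F} {t : ℝ}
    (hG : DifferentiableAt ℝ G (x t)) (hpos : ∀ v, v ≠ 0 → 0 < G (x t) v v)
    (hx : DifferentiableAt ℝ x t) (hx' : DifferentiableAt ℝ (deriv x) t) :
    EulerLagrangeAt G x t ↔ deriv (deriv x) t = sprayAcc G (x t) (deriv x t) := by
  rw [eulerLagrangeAt_iff hG hx hx']
  constructor
  · intro h
    by_contra hne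
    have h1 := hpos _ (sub_ne_zero.2 hne)
    -- Testing the equation with the defect `d` itself gives `G(d, d) = 0`, which definiteness
    -- forbids for `d ≠ 0`.
    set d := deriv (deriv x) t - sprayAcc G (x t) (deriv x t) with hd
    have h2 : G (x t) d d = 0 := by
      have h3 : G (x t) d d =
          G (x t) (deriv (deriv x) t) d - G (x t) (sprayAcc G (x t) (deriv x t)) d := by
        rw [← sub_apply, ← map_sub]
      rw [h3, form_sprayAcc hpos]
      linarith [h d]
    linarith
  · intro h w
    rw [h, form_sprayAcc hpos]
    ring

/-- A solution of the Euler-Lagrange equation whose position and velocity stay in compact sets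
extends. -/
lemma exists_eulerLagrange_extension {G : F → F →L[ℝ] F →L[ℝ] ℝ} {D : Set F} (hD : IsOpen D)
    (hG : ContDiffOn ℝ ∞ G D) (hpos : ∀ x ∈ D, ∀ v, v ≠ 0 → 0 < G x v v) {B : Set F}
    (hB : IsCompact B) (hBD : B ⊆ D) {y : ℝ → F} {a b L : ℝ} (hab : a < b)
    (hy : ContDiffOn ℝ 2 y (Ioo a b)) (hyB : ∀ t ∈ Ioo a b, y t ∈ B ∧ ‖deriv y t‖ ≤ L)
    (hyE : ∀ t ∈ Ioo a b, EulerLagrangeAt G y t) :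
    ∃ b' > b, ∃ x : ℝ → F, ContDiffOn ℝ 2 x (Ioo a b') ∧ MapsTo x (Ioo a b') D ∧
      (∀ t ∈ Ioo a b', EulerLagrangeAt G x t) ∧ ∀ t ∈ Ioo a b, x t = y t := by
  have hGd : ∀ u ∈ D, DifferentiableAt ℝ G u := fun u hu =>
    (hG.contDiffAt (hD.mem_nhds hu)).differentiableAt (by simp)
  have hyC : ∀ t ∈ Ioo a b, ContDiffAt ℝ 2 y t := fun t ht =>
    hy.contDiffAt (isOpen_Ioo.mem_nhds ht)
  have hyd : ∀ t ∈ Ioo a b, DifferentiableAt ℝ y t := fun t ht =>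
    (hyC t ht).differentiableAt (by norm_num)
  have hyd' : ∀ t ∈ Ioo a b, DifferentiableAt ℝ (deriv y) t := fun t ht =>
    (ContDiffAt.derivWithin (m := 1) (hyC t ht) (by norm_num)).differentiableAt (by norm_num)
  have hspray := contDiffOn_sprayAcc hD hG hpos
  have hXC : ContDiffOn ℝ 1 (fun z : F × F => (z.2, sprayAcc G z.1 z.2)) (D ×ˢ univ) :=
    contDiff_snd.contDiffOn.prodMk hspray
  have hsol : ∀ t ∈ Ioo a b, HasDerivAt (fun s => (y s, deriv y s))
      (deriv y t, sprayAcc G (y t) (deriv y t)) t := by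
    intro t ht
    have hyD : y t ∈ D := hBD (hyB t ht).1
    rw [← (eulerLagrangeAt_iff_deriv_eq_sprayAcc (hGd _ hyD) (hpos _ hyD) (hyd t ht)
      (hyd' t ht)).1 (hyE t ht)]
    exact (hyd t ht).hasDerivAt.prodMk (hyd' t ht).hasDerivAt
  -- The pair (position, velocity) stays in the compact set `B × closedBall 0 L`.
  obtain ⟨b', hb', ζ, hζ, hζeq⟩ := exists_extension_of_mem_compact
    (hD.prod isOpen_univ) hXC (hB.prod (isCompact_closedBall (0 : F) L))
    (prod_mono hBD (subset_univ _)) hab hsol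
    (fun t ht => ⟨(hyB t ht).1, by simpa using (hyB t ht).2⟩)
  have hx1 : ∀ t ∈ Ioo a b', HasDerivAt (fun s => (ζ s).1) (ζ t).2 t := fun t ht =>
    (hζ t ht).2.fst
  have hx2 : ∀ t ∈ Ioo a b', HasDerivAt (fun s => (ζ s).2) (sprayAcc G (ζ t).1 (ζ t).2) t :=
    fun t ht => (hζ t ht).2.snd
  have hdx : ∀ t ∈ Ioo a b', deriv (fun s => (ζ s).1) =ᶠ[𝓝 t] fun s => (ζ s).2 := by
    intro t ht
    filter_upwards [isOpen_Ioo.mem_nhds ht] with s hs using (hx1 s hs).deriv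
  have hζc : ContinuousOn ζ (Ioo a b') := fun t ht =>
    (hζ t ht).2.continuousAt.continuousWithinAt
  refine ⟨b', hb', fun s => (ζ s).1, ?_, fun t ht => (hζ t ht).1.1, ?_, ?_⟩
  · have h1 : ContDiffOn ℝ 1 (fun s => (ζ s).2) (Ioo a b') := by
      rw [show (1 : ℕ∞ω) = 0 + 1 by norm_num, contDiffOn_succ_iff_deriv_of_isOpen isOpen_Ioo]
      refine ⟨fun t ht => (hx2 t ht).differentiableAt.differentiableWithinAt, by simp, ?_⟩
      rw [contDiffOn_zero]
      refine ContinuousOn.congr ?_ fun t ht => (hx2 t ht).deriv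
      exact hspray.continuousOn.comp hζc fun t ht => (hζ t ht).1
    rw [show (2 : ℕ∞ω) = 1 + 1 by norm_num, contDiffOn_succ_iff_deriv_of_isOpen isOpen_Ioo]
    refine ⟨fun t ht => (hx1 t ht).differentiableAt.differentiableWithinAt, by simp, ?_⟩
    exact h1.congr fun t ht => (hx1 t ht).deriv
  · intro t ht
    have hxD := (hζ t ht).1.1
    rw [eulerLagrangeAt_iff_deriv_eq_sprayAcc (hGd _ hxD) (hpos _ hxD)
      (hx1 t ht).differentiableAt
      ((hx2 t ht).congr_of_eventuallyEq (hdx t ht)).differentiableAt, (hdx t ht).deriv_eq,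
      (hx2 t ht).deriv, (hx1 t ht).deriv]
  · intro t ht
    simp only [hζeq t ht.2]

end Spray

end EulerLagrange

/-! ### Metrics and geodesics in charts, and independence of the chart. -/

section Charts

variable {F : Type*} [NormedAddCommGroup F] [NormedSpace ℝ F] [FiniteDimensional ℝ F]
  {H : Type*} [TopologicalSpace H] {I : ModelWithCorners ℝ F H}
  {M : Type*} [TopologicalSpace M] [ChartedSpace H M]

/-- The coordinate expression of `g` in the chart around `p`, as a continuous bilinear map. -/
def chartBilin (g : BilinField I M) (p : M) (u : F) : F →L[ℝ] F →L[ℝ] ℝ :=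
  let A : F →ₗ[ℝ] TangentSpace I ((extChartAt I p).symm u) :=
    (mfderiv 𝓘(ℝ, F) I (extChartAt I p).symm u).toLinearMap
  LinearMap.toContinuousBilinearMap ((g ((extChartAt I p).symm u)).compl₁₂ A A)

lemma chartBilin_apply (g : BilinField I M) (p : M) (u v w : F) :
    chartBilin g p u v w = chartForm g p u v w := rfl

/-- The part of the target of the chart around `p` which corresponds to `U`. -/
def chartDomain (I : ModelWithCorners ℝ F H) (p : M) (U : Set M) : Set F :=
  (extChartAt I p).target ∩ (extChartAt I p).symm ⁻¹' U

lemma isOpen_chartDomain [I.Boundaryless] (p : M) {U : Set M} (hU : IsOpen U) :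
    IsOpen (chartDomain I p U) :=
  (continuousOn_extChartAt_symm p).isOpen_inter_preimage (isOpen_extChartAt_target p) hU

lemma extChartAt_mem_chartDomain {p q : M} {U : Set M} (hq : q ∈ (chartAt H p).source)
    (hqU : q ∈ U) : extChartAt I p q ∈ chartDomain I p U := by
  have hq' : q ∈ (extChartAt I p).source := by rwa [extChartAt_source]
  exact ⟨(extChartAt I p).map_source hq', by
    rw [mem_preimage, (extChartAt I p).left_inv hq']; exact hqU⟩

lemma IsRiemannianMetricOn.contDiffOn_chartBilin {g : BilinField I M} {U : Set M}
    (hg : IsRiemannianMetricOn g U) (p : M) :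
    ContDiffOn ℝ ∞ (chartBilin g p) (chartDomain I p U) :=
  contDiffOn_clm_apply.2 fun v => contDiffOn_clm_apply.2 fun w => hg.smooth p v w

lemma IsRiemannianMetricOn.differentiableAt_chartBilin [I.Boundaryless] {g : BilinField I M}
    {U : Set M} (hU : IsOpen U) (hg : IsRiemannianMetricOn g U) {p : M} {u : F}
    (hu : u ∈ chartDomain I p U) : DifferentiableAt ℝ (chartBilin g p) u :=
  ((hg.contDiffOn_chartBilin p).contDiffAt
    ((isOpen_chartDomain p hU).mem_nhds hu)).differentiableAt (by simp)

lemma IsRiemannianMetricOn.chartBilin_symm {g : BilinField I M} {U : Set M}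
    (hg : IsRiemannianMetricOn g U) {p : M} {u : F} (hu : u ∈ chartDomain I p U) (v w : F) :
    chartBilin g p u v w = chartBilin g p u w v :=
  hg.symm _ hu.2 _ _

/-- Moves vectors between tangent spaces at equal points without casts, all of them being `F`. -/
lemma form_congr_point (g : BilinField I M) {p q : M} (h : p = q) (v w : F) :
    g p v w = g q v w := by
  subst h; rfl

variable [I.Boundaryless]

section

variable [IsManifold I ∞ M]

lemma mdifferentiableAt_extChartAt_symm {p : M} {u : F} (hu : u ∈ (extChartAt I p).target) :
    MDifferentiableAt 𝓘(ℝ, F) I (extChartAt I p).symm u := by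
  have : IsManifold I 1 M := IsManifold.of_le (n := ∞) (by norm_cast)
  have h := mdifferentiableWithinAt_extChartAt_symm (I := I) hu
  rwa [I.range_eq_univ, mdifferentiableWithinAt_univ] at h

lemma mfderiv_extChartAt_symm_injective {p : M} {u : F} (hu : u ∈ (extChartAt I p).target) :
    Function.Injective (mfderiv 𝓘(ℝ, F) I (extChartAt I p).symm u) := by
  have : IsManifold I 1 M := IsManifold.of_le (n := ∞) (by norm_cast)
  have h := isInvertible_mfderivWithin_extChartAt_symm (I := I) hu
  rw [I.range_eq_univ, mfderivWithin_univ] at h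
  exact h.injective

lemma IsRiemannianMetricOn.chartBilin_pos {g : BilinField I M} {U : Set M}
    (hg : IsRiemannianMetricOn g U) {p : M} {u : F} (hu : u ∈ chartDomain I p U) {v : F}
    (hv : v ≠ 0) : 0 < chartBilin g p u v v := by
  refine hg.pos _ hu.2 _ fun h0 => hv ?_
  exact mfderiv_extChartAt_symm_injective hu.1 (h0.trans (map_zero _).symm)

lemma contDiffAt_chart_transition {p q : M} {u : F} (hu : u ∈ (extChartAt I p).target)
    (hq : (extChartAt I p).symm u ∈ (chartAt H q).source) :
    ContDiffAt ℝ ∞ (extChartAt I q ∘ (extChartAt I p).symm) u := by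
  rw [← contMDiffAt_iff_contDiffAt]
  have h1 : ContMDiffAt 𝓘(ℝ, F) I ∞ (extChartAt I p).symm u :=
    (contMDiffOn_extChartAt_symm p).contMDiffAt ((isOpen_extChartAt_target p).mem_nhds hu)
  exact (contMDiffAt_extChartAt' hq).comp u h1

/-- Chain rule: near `u` the inverse chart at `p` is the inverse chart at `q` composed with the
transition map. This is the relation `G = φ^* G'` required by `EulerLagrangeAt.map`. -/
lemma chartBilin_eq_transition (g : BilinField I M) {p q : M} {u : F}
    (hu : u ∈ (extChartAt I p).target)
    (hq : (extChartAt I p).symm u ∈ (chartAt H q).source) (v w : F) :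
    chartBilin g p u v w =
      chartBilin g q ((extChartAt I q ∘ (extChartAt I p).symm) u)
        (fderiv ℝ (extChartAt I q ∘ (extChartAt I p).symm) u v)
        (fderiv ℝ (extChartAt I q ∘ (extChartAt I p).symm) u w) := by
  set φ := extChartAt I q ∘ (extChartAt I p).symm with hφ
  have hq' : (extChartAt I p).symm u ∈ (extChartAt I q).source := by rwa [extChartAt_source]
  have hφt : φ u ∈ (extChartAt I q).target := (extChartAt I q).map_source hq'
  have hev : (extChartAt I p).symm =ᶠ[𝓝 u] (extChartAt I q).symm ∘ φ := by
    have h1 : ContinuousAt (extChartAt I p).symm u :=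
      (continuousOn_extChartAt_symm p).continuousAt ((isOpen_extChartAt_target p).mem_nhds hu)
    filter_upwards [h1.eventually ((isOpen_extChartAt_source (I := I) q).mem_nhds hq')] with z hz
    exact ((extChartAt I q).left_inv hz).symm
  have hd : mfderiv 𝓘(ℝ, F) I (extChartAt I p).symm u =
      (mfderiv 𝓘(ℝ, F) I (extChartAt I q).symm (φ u)).comp (fderiv ℝ φ u) := by
    rw [hev.mfderiv_eq, mfderiv_comp u (mdifferentiableAt_extChartAt_symm hφt)
      ((contDiffAt_chart_transition hu hq).differentiableAt (by simp)).mdifferentiableAt,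
      mfderiv_eq_fderiv]
    rfl
  rw [chartBilin_apply, chartBilin_apply, chartForm, chartForm, hd]
  exact form_congr_point g hev.eq_of_nhds _ _

/-- The geodesic equation does not depend on the chart. -/
lemma EulerLagrangeAt.change_chart {g : BilinField I M} {U : Set M} (hU : IsOpen U)
    (hg : IsRiemannianMetricOn g U) {γ : ℝ → M} {t : ℝ} {p q : M}
    (h : EulerLagrangeAt (chartBilin g p) (fun s => extChartAt I p (γ s)) t)
    (hγ : ContDiffAt ℝ 2 (fun s => extChartAt I p (γ s)) t) (hγc : ContinuousAt γ t)
    (hp : γ t ∈ (chartAt H p).source) (hq : γ t ∈ (chartAt H q).source) (hγU : γ t ∈ U) :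
    EulerLagrangeAt (chartBilin g q) (fun s => extChartAt I q (γ s)) t := by
  have hp' : γ t ∈ (extChartAt I p).source := by rwa [extChartAt_source]
  have hpd := extChartAt_mem_chartDomain (I := I) hp hγU
  have hqd := extChartAt_mem_chartDomain (I := I) hq hγU
  have hut := (extChartAt I p).map_source hp'
  have hinv := (extChartAt I p).left_inv hp'
  have hq' : (extChartAt I p).symm (extChartAt I p (γ t)) ∈ (chartAt H q).source := by
    rwa [hinv]
  have hφt : (extChartAt I q ∘ (extChartAt I p).symm) (extChartAt I p (γ t)) =
      extChartAt I q (γ t) := by rw [Function.comp_apply, hinv]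
  have hrel : ∀ᶠ u in 𝓝 (extChartAt I p (γ t)), ∀ v w, chartBilin g p u v w =
      chartBilin g q ((extChartAt I q ∘ (extChartAt I p).symm) u)
        (fderiv ℝ (extChartAt I q ∘ (extChartAt I p).symm) u v)
        (fderiv ℝ (extChartAt I q ∘ (extChartAt I p).symm) u w) := by
    have h1 : ContinuousAt (extChartAt I p).symm (extChartAt I p (γ t)) :=
      (continuousOn_extChartAt_symm p).continuousAt ((isOpen_extChartAt_target p).mem_nhds hut)
    filter_upwards [h1.eventually ((chartAt H q).open_source.mem_nhds hq'),
      (isOpen_extChartAt_target p).mem_nhds hut] with u hu hu' v w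
    exact chartBilin_eq_transition g hu' hu v w
  -- A vector killed by the differential of the transition map would have length zero for the metric
  -- at `p`; injectivity gives surjectivity in finite dimension.
  have hinj : Function.Injective
      (fderiv ℝ (extChartAt I q ∘ (extChartAt I p).symm) (extChartAt I p (γ t)) : F →ₗ[ℝ] F) := by
    rw [← LinearMap.ker_eq_bot, LinearMap.ker_eq_bot']
    intro v hv
    by_contra hv0
    have h1 := hg.chartBilin_pos hpd hv0
    have h2 : fderiv ℝ (extChartAt I q ∘ (extChartAt I p).symm) (extChartAt I p (γ t)) v = 0 := hv
    rw [hrel.self_of_nhds v v, h2] at h1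
    simp at h1
  have h3 := h.map (φ := extChartAt I q ∘ (extChartAt I p).symm) (G' := chartBilin g q) hγ
    ((contDiffAt_chart_transition hut hq').of_le (by norm_cast))
    (LinearMap.injective_iff_surjective.1 hinj)
    (by rw [hφt]; exact hg.differentiableAt_chartBilin hU hqd)
    (by rw [hφt]; exact hg.chartBilin_symm hqd) hrel
    (hg.differentiableAt_chartBilin hU hpd)
  refine h3.congr ?_
  filter_upwards [hγc.eventually ((isOpen_extChartAt_source (I := I) p).mem_nhds hp')] with s hs
  exact congrArg (extChartAt I q) ((extChartAt I p).left_inv hs).symm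

lemma velocity_eq_mfderiv_symm {γ : ℝ → M} {t : ℝ} {p : M}
    (hγ : MDifferentiableAt 𝓘(ℝ, ℝ) I γ t) (hp : γ t ∈ (chartAt H p).source) :
    (velocity I γ t : F) = mfderiv 𝓘(ℝ, F) I (extChartAt I p).symm (extChartAt I p (γ t))
      (deriv (fun s => extChartAt I p (γ s)) t) := by
  have : IsManifold I 1 M := IsManifold.of_le (n := ∞) (by norm_cast)
  have hp' : γ t ∈ (extChartAt I p).source := by rwa [extChartAt_source]
  have hut := (extChartAt I p).map_source hp'
  have hev : γ =ᶠ[𝓝 t] (extChartAt I p).symm ∘ (fun s => extChartAt I p (γ s)) := by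
    filter_upwards [hγ.continuousAt.eventually
      ((isOpen_extChartAt_source (I := I) p).mem_nhds hp')] with s hs
    exact ((extChartAt I p).left_inv hs).symm
  have hx : MDifferentiableAt 𝓘(ℝ, ℝ) 𝓘(ℝ, F) (fun s => extChartAt I p (γ s)) t :=
    (mdifferentiableAt_extChartAt hp).comp t hγ
  have hd : mfderiv 𝓘(ℝ, ℝ) I γ t =
      (mfderiv 𝓘(ℝ, F) I (extChartAt I p).symm (extChartAt I p (γ t))).comp
        (mfderiv 𝓘(ℝ, ℝ) 𝓘(ℝ, F) (fun s => extChartAt I p (γ s)) t) := by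
    rw [hev.mfderiv_eq, mfderiv_comp t (mdifferentiableAt_extChartAt_symm hut) hx]
  rw [velocity, hd, mfderiv_eq_fderiv]
  rfl

lemma form_velocity_eq_chartBilin (g : BilinField I M) {γ : ℝ → M} {t : ℝ} {p : M}
    (hγ : MDifferentiableAt 𝓘(ℝ, ℝ) I γ t) (hp : γ t ∈ (chartAt H p).source) :
    g (γ t) (velocity I γ t) (velocity I γ t) =
      chartBilin g p (extChartAt I p (γ t)) (deriv (fun s => extChartAt I p (γ s)) t)
        (deriv (fun s => extChartAt I p (γ s)) t) := by
  have hp' : γ t ∈ (extChartAt I p).source := by rwa [extChartAt_source]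
  rw [chartBilin_apply, chartForm, velocity_eq_mfderiv_symm hγ hp]
  exact (form_congr_point g ((extChartAt I p).left_inv hp') _ _).symm

lemma contDiffAt_extChartAt_comp {γ : ℝ → M} {t : ℝ} {p : M} {n : ℕ∞ω} (hn : n ≤ ∞)
    (hγ : ContMDiffAt 𝓘(ℝ, ℝ) I n γ t) (hp : γ t ∈ (chartAt H p).source) :
    ContDiffAt ℝ n (fun s => extChartAt I p (γ s)) t := by
  rw [← contMDiffAt_iff_contDiffAt]
  exact ((contMDiffAt_extChartAt' (n := ∞) hp).of_le hn).comp t hγ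

end

lemma IsGeodesicOn.contMDiffAt {g : BilinField I M} {U : Set M} {γ : ℝ → M} {J : Set ℝ}
    (h : IsGeodesicOn g U γ J) {t : ℝ} (ht : t ∈ J) : ContMDiffAt 𝓘(ℝ, ℝ) I 2 γ t :=
  h.contMDiffOn.contMDiffAt (h.isOpen.mem_nhds ht)

lemma IsGeodesicOn.eulerLagrangeAt {g : BilinField I M} {U : Set M} {γ : ℝ → M} {J : Set ℝ}
    (h : IsGeodesicOn g U γ J) {t : ℝ} (ht : t ∈ J) {p : M} (hp : γ t ∈ (chartAt H p).source) :
    EulerLagrangeAt (chartBilin g p) (fun s => extChartAt I p (γ s)) t :=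
  h.geodesic_eq p t ht hp

/-- The minimum over the compact set `B × unit sphere` is positive, and homogeneity extends the
bound to all vectors. It converts metric speed into coordinate speed. -/
lemma exists_coercive {G : F → F →L[ℝ] F →L[ℝ] ℝ} {B : Set F}
    (hB : IsCompact B) (hG : ContinuousOn G B) (hpos : ∀ u ∈ B, ∀ v, v ≠ 0 → 0 < G u v v) :
    ∃ μ > 0, ∀ u ∈ B, ∀ v, μ * ‖v‖ ^ 2 ≤ G u v v := by
  have hc : ContinuousOn (fun z : F × F => G z.1 z.2 z.2) (B ×ˢ Metric.sphere (0 : F) 1) := by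
    have h1 : ContinuousOn (fun z : F × F => G z.1) (B ×ˢ Metric.sphere (0 : F) 1) :=
      hG.comp continuousOn_fst fun z hz => hz.1
    exact (h1.clm_apply continuousOn_snd).clm_apply continuousOn_snd
  have hp : ∀ z ∈ B ×ˢ Metric.sphere (0 : F) 1, 0 < G z.1 z.2 z.2 := fun z hz =>
    hpos _ hz.1 _ (ne_zero_of_mem_unit_sphere (⟨z.2, hz.2⟩ : Metric.sphere (0 : F) 1))
  obtain ⟨μ, hμ, h⟩ := (hB.prod (isCompact_sphere (0 : F) 1)).exists_forall_le' hc hp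
  refine ⟨μ, hμ, fun u hu v => ?_⟩
  rcases eq_or_ne v 0 with rfl | hv
  · simp
  have hv' : ‖v‖ ≠ 0 := norm_ne_zero_iff.2 hv
  have h1 := h (u, ‖v‖⁻¹ • v) ⟨hu, by simp [norm_smul, hv']⟩
  simp only [map_smul, smul_apply, smul_eq_mul] at h1
  rw [← mul_assoc, ← mul_inv, ← sq] at h1
  have h2 := mul_le_mul_of_nonneg_left h1 (sq_nonneg ‖v‖)
  rw [← mul_assoc, mul_inv_cancel₀ (pow_ne_zero 2 hv'), one_mul] at h2
  linarith

end Charts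

/-! ### Extension of unit speed geodesics that stay in a compact set. -/

section Extension

variable {F : Type*} [NormedAddCommGroup F] [NormedSpace ℝ F] [FiniteDimensional ℝ F]
  {H : Type*} [TopologicalSpace H] {I : ModelWithCorners ℝ F H} [I.Boundaryless]
  {M : Type*} [TopologicalSpace M] [ChartedSpace H M] [IsManifold I ∞ M]

/-- A curve which starts near the centre of a chart and has bounded coordinate velocity cannot leave
a coordinate ball in a short time. -/
lemma extChartAt_mem_ball_of_velocity_bound [T2Space M] {γ : ℝ → M} {p : M} {u₀ : F}
    {a b ρ L : ℝ} (hL : 0 ≤ L)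
    (hball : Metric.ball u₀ ρ ⊆ (extChartAt I p).target)
    (hγ : ContinuousOn γ (Ico a b))
    (hd : ∀ t ∈ Ico a b, γ t ∈ (chartAt H p).source → extChartAt I p (γ t) ∈ Metric.ball u₀ ρ →
      DifferentiableAt ℝ (fun s => extChartAt I p (γ s)) t ∧
        ‖deriv (fun s => extChartAt I p (γ s)) t‖ ≤ L)
    (ha : γ a ∈ (chartAt H p).source) (ha' : dist (extChartAt I p (γ a)) u₀ < ρ / 2)
    (hab : L * (b - a) < ρ / 2) :
    ∀ t ∈ Ico a b, γ t ∈ (chartAt H p).source ∧ extChartAt I p (γ t) ∈ Metric.ball u₀ ρ := by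
  set O : Set M := (extChartAt I p).source ∩ extChartAt I p ⁻¹' Metric.ball u₀ ρ with hOdef
  have hO : IsOpen O := (continuousOn_extChartAt p).isOpen_inter_preimage
    (isOpen_extChartAt_source p) Metric.isOpen_ball
  suffices h : ∀ t ∈ Ico a b, γ t ∈ O by
    intro t ht
    have := h t ht
    exact ⟨by rw [← extChartAt_source I]; exact this.1, this.2⟩
  by_contra! hcon
  obtain ⟨T, hT, hTO⟩ := hcon
  have hsub : Icc a T ⊆ Ico a b := fun s hs => ⟨hs.1, hs.2.trans_lt hT.2⟩
  have hAc : IsCompact (Icc a T ∩ γ ⁻¹' Oᶜ) :=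
    isCompact_Icc.of_isClosed_subset
      ((hγ.mono hsub).preimage_isClosed_of_isClosed isClosed_Icc hO.isClosed_compl)
      inter_subset_left
  -- `τ` is the first exit time. Before `τ` the coordinates remain in the closed ball of radius `ρ'
  -- < ρ`.
  obtain ⟨τ, ⟨hτI, hτO⟩, hτmin⟩ := hAc.exists_isLeast ⟨T, ⟨hT.1, le_rfl⟩, hTO⟩
  have hlt : ∀ t ∈ Ico a τ, γ t ∈ O := by
    intro t ht
    by_contra h
    exact absurd (hτmin ⟨⟨ht.1, ht.2.le.trans hτI.2⟩, h⟩) (not_le.2 ht.2)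
  have haO : γ a ∈ O := by
    refine ⟨by rwa [extChartAt_source], ?_⟩
    rw [mem_preimage, Metric.mem_ball]
    linarith [dist_nonneg (x := extChartAt I p (γ a)) (y := u₀)]
  have haτ : a < τ := lt_of_le_of_ne hτI.1 (by rintro rfl; exact hτO haO)
  set ρ' := dist (extChartAt I p (γ a)) u₀ + L * (b - a) with hρ'
  have hρρ' : ρ' < ρ := by linarith
  have hτb : τ < b := hτI.2.trans_lt hT.2
  have hdist : ∀ t ∈ Ico a τ, extChartAt I p (γ t) ∈ Metric.closedBall u₀ ρ' := by
    intro t ht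
    have hdt : ∀ s ∈ Ico a τ, DifferentiableAt ℝ (fun s => extChartAt I p (γ s)) s ∧
        ‖deriv (fun s => extChartAt I p (γ s)) s‖ ≤ L := fun s hs =>
      hd s ⟨hs.1, hs.2.trans hτb⟩ (by rw [← extChartAt_source I]; exact (hlt s hs).1) (hlt s hs).2
    have h1 := (convex_Ico a τ).norm_image_sub_le_of_norm_deriv_le
      (fun s hs => (hdt s hs).1) (fun s hs => (hdt s hs).2) ⟨le_rfl, haτ⟩ ht
    rw [Metric.mem_closedBall]
    have h2 := dist_triangle (extChartAt I p (γ t)) (extChartAt I p (γ a)) u₀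
    rw [dist_eq_norm (extChartAt I p (γ t)) (extChartAt I p (γ a))] at h2
    have h3 : L * ‖t - a‖ ≤ L * (b - a) := by
      refine mul_le_mul_of_nonneg_left ?_ hL
      rw [Real.norm_eq_abs, abs_of_nonneg (by linarith [ht.1])]
      linarith [ht.2]
    linarith
  -- This compact image is closed because `M` is Hausdorff, so it contains the limit `γ τ`; without
  -- this the curve might leave the chart domain at `τ` although its coordinates converge.
  have hcomp : IsCompact ((extChartAt I p).symm '' Metric.closedBall u₀ ρ') := by
    refine (isCompact_closedBall u₀ ρ').image_of_continuousOn ?_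
    exact (continuousOn_extChartAt_symm p).mono
      ((Metric.closedBall_subset_ball hρρ').trans hball)
  have hτmem : γ τ ∈ (extChartAt I p).symm '' Metric.closedBall u₀ ρ' := by
    have hcont : Tendsto γ (𝓝[<] τ) (𝓝 (γ τ)) := by
      have h1 : Tendsto γ (𝓝[Ico a τ] τ) (𝓝 (γ τ)) :=
        (hγ τ ⟨hτI.1, hτb⟩).mono_left
          (nhdsWithin_mono _ fun s hs => ⟨hs.1, hs.2.trans hτb⟩)
      rwa [nhdsWithin_Ico_eq_nhdsLT haτ] at h1
    refine hcomp.isClosed.mem_of_tendsto hcont ?_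
    filter_upwards [Ico_mem_nhdsLT haτ] with t ht
    exact ⟨_, hdist t ht, (extChartAt I p).left_inv (hlt t ht).1⟩
  obtain ⟨u, hu, huτ⟩ := hτmem
  have hub := Metric.closedBall_subset_ball hρρ' hu
  apply hτO
  rw [← huτ]
  refine ⟨(extChartAt I p).map_target (hball hub), ?_⟩
  rw [mem_preimage, (extChartAt I p).right_inv (hball hub)]
  exact hub

lemma IsUnitSpeedGeodesicOn.chartBilin_deriv {g : BilinField I M} {U : Set M} {γ : ℝ → M}
    {J : Set ℝ} (h : IsUnitSpeedGeodesicOn g U γ J) {t : ℝ} (ht : t ∈ J) {p : M}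
    (hp : γ t ∈ (chartAt H p).source) :
    chartBilin g p (extChartAt I p (γ t)) (deriv (fun s => extChartAt I p (γ s)) t)
      (deriv (fun s => extChartAt I p (γ s)) t) = 1 := by
  rw [← form_velocity_eq_chartBilin g
    ((h.toIsGeodesicOn.contMDiffAt ht).mdifferentiableAt (by norm_num)) hp]
  exact h.unit_speed t ht

/-- A geodesic whose coordinates stay in a compact set and have bounded velocity extends beyond the
right end of its interval of definition, as a solution of the geodesic equation in this chart. -/
lemma exists_chart_extension {g : BilinField I M} {U : Set M} (hU : IsOpen U)
    (hg : IsRiemannianMetricOn g U) {γ : ℝ → M} {a b : ℝ} (hab : a < b)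
    (hγ : IsGeodesicOn g U γ (Ioo a b)) {p : M} {B : Set F} (hB : IsCompact B)
    (hBD : B ⊆ chartDomain I p U) {L : ℝ}
    (hγB : ∀ t ∈ Ioo a b, γ t ∈ (chartAt H p).source ∧ extChartAt I p (γ t) ∈ B ∧
      ‖deriv (fun s => extChartAt I p (γ s)) t‖ ≤ L) :
    ∃ b' > b, ∃ x : ℝ → F, ContDiffOn ℝ 2 x (Ioo a b') ∧ MapsTo x (Ioo a b') (chartDomain I p U) ∧
      (∀ t ∈ Ioo a b', EulerLagrangeAt (chartBilin g p) x t) ∧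
      ∀ t ∈ Ioo a b, x t = extChartAt I p (γ t) := by
  have hDo : IsOpen (chartDomain I p U) := isOpen_chartDomain p hU
  have hyC : ContDiffOn ℝ 2 (fun s => extChartAt I p (γ s)) (Ioo a b) := fun t ht =>
    (contDiffAt_extChartAt_comp (by norm_cast) (hγ.contMDiffAt ht) (hγB t ht).1).contDiffWithinAt
  exact exists_eulerLagrange_extension hDo (hg.contDiffOn_chartBilin p)
    (fun x hx v hv => hg.chartBilin_pos hx hv) hB hBD hab hyC
    (fun t ht => (hγB t ht).2) (fun t ht => hγ.eulerLagrangeAt ht (hγB t ht).1)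

/-- A unit speed geodesic on `(a, b)` which stays near `b` in a compact set extends beyond `b`. -/
theorem IsUnitSpeedGeodesicOn.exists_extension [T2Space M] {g : BilinField I M} {U : Set M}
    (hU : IsOpen U) (hg : IsRiemannianMetricOn g U) {γ : ℝ → M} {a b : ℝ} (hab : a < b)
    (hγ : IsUnitSpeedGeodesicOn g U γ (Ioo a b)) {K : Set M} (hK : IsCompact K) (hKU : K ⊆ U)
    (hγK : ∀ᶠ t in 𝓝[<] b, γ t ∈ K) :
    ∃ b' > b, ∃ γ' : ℝ → M, IsGeodesicOn g U γ' (Ioo a b') ∧ EqOn γ' γ (Ioo a b) := by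
  have hγg := hγ.toIsGeodesicOn
  -- Compactness gives only a cluster point, so the curve is first known to visit the chart near `p`
  -- at times arbitrarily close to `b`.
  obtain ⟨p, hpK, hp⟩ := hK.exists_clusterPt (f := map γ (𝓝[<] b)) (le_principal_iff.2 hγK)
  have hpp := mem_chart_source H p
  set u₀ := extChartAt I p p with hu₀
  have hu₀D : u₀ ∈ chartDomain I p U := extChartAt_mem_chartDomain hpp (hKU hpK)
  obtain ⟨ρ, hρ, hρD⟩ := Metric.nhds_basis_closedBall.mem_iff.1
    ((isOpen_chartDomain p hU).mem_nhds hu₀D)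
  obtain ⟨μ, hμ, hcoer⟩ := exists_coercive (isCompact_closedBall u₀ ρ)
    ((hg.contDiffOn_chartBilin p).continuousOn.mono hρD)
    (fun u hu v hv => hg.chartBilin_pos (hρD hu) hv)
  -- Unit speed and coercivity give `μ ‖ẋ‖² ≤ 1`.
  set L := Real.sqrt (1 / μ) with hL
  have hL0 : 0 ≤ L := Real.sqrt_nonneg _
  have hbound : ∀ t ∈ Ioo a b, γ t ∈ (chartAt H p).source →
      extChartAt I p (γ t) ∈ Metric.ball u₀ ρ →
      DifferentiableAt ℝ (fun s => extChartAt I p (γ s)) t ∧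
        ‖deriv (fun s => extChartAt I p (γ s)) t‖ ≤ L := by
    intro t ht hs hb
    refine ⟨(contDiffAt_extChartAt_comp (by norm_cast) (hγg.contMDiffAt ht) hs).differentiableAt
      (by norm_num), ?_⟩
    have h1 := hcoer _ (Metric.ball_subset_closedBall hb)
      (deriv (fun s => extChartAt I p (γ s)) t)
    rw [hγ.chartBilin_deriv ht hs] at h1
    refine Real.le_sqrt_of_sq_le ?_
    rw [le_div_iff₀ hμ]
    linarith
  -- From `t₁` on the curve is trapped: it starts within `ρ / 2` of the centre and can travel less
  -- than `ρ / 2` before `b`.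
  obtain ⟨t₁, ht₁, hst₁, hdt₁, hLt₁⟩ : ∃ t₁ ∈ Ioo a b, γ t₁ ∈ (chartAt H p).source ∧
      dist (extChartAt I p (γ t₁)) u₀ < ρ / 2 ∧ L * (b - t₁) < ρ / 2 := by
    have hN : ∀ᶠ q in 𝓝 p, q ∈ (chartAt H p).source ∧ dist (extChartAt I p q) u₀ < ρ / 2 := by
      refine ((chartAt H p).open_source.eventually_mem hpp).and ?_
      exact (continuousAt_extChartAt p).eventually (Metric.ball_mem_nhds _ (half_pos hρ))
    have hfreq : ∃ᶠ t in 𝓝[<] b, γ t ∈ (chartAt H p).source ∧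
        dist (extChartAt I p (γ t)) u₀ < ρ / 2 := by
      have := hp.frequently hN
      rwa [frequently_map] at this
    have hlim : ∀ᶠ t in 𝓝[<] b, L * (b - t) < ρ / 2 := by
      have h1 : Continuous fun t : ℝ => L * (b - t) := by fun_prop
      have h2 := (h1.tendsto b).mono_left (nhdsWithin_le_nhds (s := Iio b))
      refine h2.eventually (Iio_mem_nhds ?_)
      simpa using half_pos hρ
    obtain ⟨t, ⟨h1, h2⟩, h3, h4⟩ :=
      (hfreq.and_eventually (hlim.and (Ioo_mem_nhdsLT hab))).exists
    exact ⟨t, h4, h1, h2, h3⟩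
  have hsub : Ico t₁ b ⊆ Ioo a b := fun t ht => ⟨ht₁.1.trans_le ht.1, ht.2⟩
  have hstay := extChartAt_mem_ball_of_velocity_bound hL0
    (fun u hu => (hρD (Metric.ball_subset_closedBall hu)).1)
    (hγg.contMDiffOn.continuousOn.mono hsub) (fun t ht => hbound t (hsub ht)) hst₁ hdt₁ hLt₁
  have hsub' : Ioo t₁ b ⊆ Ioo a b := fun t ht => ⟨ht₁.1.trans ht.1, ht.2⟩
  have hγ₁ : IsGeodesicOn g U γ (Ioo t₁ b) :=
    ⟨isOpen_Ioo, ordConnected_Ioo, nonempty_Ioo.2 ht₁.2, hγg.contMDiffOn.mono hsub',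
      hγg.mapsTo.mono_left hsub', fun q t ht => hγg.geodesic_eq q t (hsub' ht)⟩
  obtain ⟨b', hb', x, hxC, hxD, hxE, hxeq⟩ := exists_chart_extension hU hg ht₁.2 hγ₁
    (isCompact_closedBall u₀ ρ) hρD (fun t ht =>
      have h := hstay t ⟨ht.1.le, ht.2⟩
      ⟨h.1, Metric.ball_subset_closedBall h.2, (hbound t (hsub' ht) h.1 h.2).2⟩)
  set γ' : ℝ → M := fun t => if t < b then γ t else (extChartAt I p).symm (x t) with hγ'
  have hlt : ∀ t < b, γ' t = γ t := fun t ht => if_pos ht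
  -- Both branches agree on the overlap `(t₁, b)`, so the glued curve has no corner at `b`.
  have hge : ∀ t ∈ Ioo t₁ b', γ' t = (extChartAt I p).symm (x t) := by
    intro t ht
    by_cases h : t < b
    · rw [hlt t h, hxeq t ⟨ht.1, h⟩, (extChartAt I p).left_inv]
      rw [extChartAt_source]
      exact (hstay t ⟨ht.1.le, h⟩).1
    · exact if_neg h
  have hevlt : ∀ t < b, γ' =ᶠ[𝓝 t] γ := fun t ht => by
    filter_upwards [Iio_mem_nhds ht] with s hs using hlt s hs
  have hevge : ∀ t ∈ Ioo t₁ b', γ' =ᶠ[𝓝 t] (extChartAt I p).symm ∘ x := fun t ht => by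
    filter_upwards [isOpen_Ioo.mem_nhds ht] with s hs using hge s hs
  have hright : ∀ t ∈ Ioo a b', ¬ t < b → t ∈ Ioo t₁ b' := fun t ht h =>
    ⟨ht₁.2.trans_le (not_lt.1 h), ht.2⟩
  have hxCM : ∀ t ∈ Ioo t₁ b', ContMDiffAt 𝓘(ℝ, ℝ) I 2 γ' t := by
    intro t ht
    have h1 : ContMDiffAt 𝓘(ℝ, F) I 2 (extChartAt I p).symm (x t) :=
      ((contMDiffOn_extChartAt_symm (n := ∞) p).contMDiffAt
        ((isOpen_extChartAt_target p).mem_nhds (hxD ht).1)).of_le (by norm_cast)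
    have h2 : ContMDiffAt 𝓘(ℝ, ℝ) 𝓘(ℝ, F) 2 x t :=
      contMDiffAt_iff_contDiffAt.2 (hxC.contDiffAt (isOpen_Ioo.mem_nhds ht))
    exact (h1.comp t h2).congr_of_eventuallyEq (hevge t ht)
  have hsrc : ∀ t ∈ Ioo t₁ b', γ' t ∈ (chartAt H p).source := by
    intro t ht
    rw [hge t ht, ← extChartAt_source I]
    exact (extChartAt I p).map_target (hxD ht).1
  have hcoord : ∀ t ∈ Ioo t₁ b', (fun s => extChartAt I p (γ' s)) =ᶠ[𝓝 t] x := fun t ht => by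
    filter_upwards [isOpen_Ioo.mem_nhds ht] with s hs
    rw [hge s hs, (extChartAt I p).right_inv (hxD hs).1]
  have hmaps : MapsTo γ' (Ioo a b') U := by
    intro t ht
    by_cases h : t < b
    · rw [hlt t h]; exact hγg.mapsTo ⟨ht.1, h⟩
    · rw [hge t (hright t ht h)]; exact (hxD (hright t ht h)).2
  refine ⟨b', hb', γ', ⟨isOpen_Ioo, ordConnected_Ioo, nonempty_Ioo.2 (hab.trans hb'), ?_, hmaps,
    ?_⟩, fun t ht => hlt t ht.2⟩
  · intro t ht
    by_cases h : t < b
    · exact ((hγg.contMDiffAt ⟨ht.1, h⟩).congr_of_eventuallyEq (hevlt t h)).contMDiffWithinAt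
    · exact (hxCM t (hright t ht h)).contMDiffWithinAt
  · intro q t ht hq
    change EulerLagrangeAt (chartBilin g q) (fun s => extChartAt I q (γ' s)) t
    by_cases h : t < b
    · refine EulerLagrangeAt.congr (x := fun s => extChartAt I q (γ s))
        (hγg.eulerLagrangeAt ⟨ht.1, h⟩ (hlt t h ▸ hq)) ?_
      filter_upwards [hevlt t h] with s hs
      rw [hs]
    · have ht' := hright t ht h
      refine EulerLagrangeAt.change_chart hU hg ((hxE t ht').congr (hcoord t ht')) ?_
        (hxCM t ht').continuousAt (hsrc t ht') hq (hmaps ht)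
      exact (hxC.contDiffAt (isOpen_Ioo.mem_nhds ht')).congr_of_eventuallyEq (hcoord t ht')

end Extension

/-! ### The generalized warped product in product charts; the radial geodesic equation. -/

section WarpedCharts

variable {E : Type*} [NormedAddCommGroup E] [NormedSpace ℝ E] [FiniteDimensional ℝ E]
  {Y : Type*} [TopologicalSpace Y] [ChartedSpace E Y]

lemma diffR_apply (p : ℝ × Y) (v : ℝ × E) : diffR (E := E) p v = v.1 := by
  have h := mfderiv_fst (I := 𝓘(ℝ, ℝ)) (I' := 𝓘(ℝ, E)) (x := p)
  exact congrArg (fun T : ℝ × E →L[ℝ] ℝ => T v) h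

lemma diffY_apply (p : ℝ × Y) (v : ℝ × E) : (diffY (E := E) p v : E) = v.2 := by
  have h := mfderiv_snd (I := 𝓘(ℝ, ℝ)) (I' := 𝓘(ℝ, E)) (x := p)
  exact congrArg (fun T : ℝ × E →L[ℝ] E => T v) h

lemma warpedForm_apply (f : ℝ → ℝ) (h : ℝ → BilinField 𝓘(ℝ, E) Y) (p : ℝ × Y) (v w : ℝ × E) :
    warpedForm f h p v w = v.1 * w.1 + f p.1 ^ 2 * h p.1 p.2 v.2 w.2 := by
  change diffR (E := E) p v * diffR (E := E) p w +
    f p.1 ^ 2 * h p.1 p.2 (diffY p v) (diffY p w) = _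
  rw [diffR_apply, diffR_apply]
  erw [diffY_apply, diffY_apply]

lemma extChartAt_cylinder_apply (p q : ℝ × Y) :
    extChartAt (𝓘(ℝ, ℝ).prod 𝓘(ℝ, E)) p q = (q.1, extChartAt 𝓘(ℝ, E) p.2 q.2) := by
  rw [extChartAt_prod]; rfl

lemma extChartAt_cylinder_symm (p : ℝ × Y) :
    ((extChartAt (𝓘(ℝ, ℝ).prod 𝓘(ℝ, E)) p).symm : ℝ × E → ℝ × Y) =
      fun z => (z.1, (extChartAt 𝓘(ℝ, E) p.2).symm z.2) := by
  rw [extChartAt_prod]; rfl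

lemma mem_extChartAt_cylinder_target (p : ℝ × Y) (z : ℝ × E) :
    z ∈ (extChartAt (𝓘(ℝ, ℝ).prod 𝓘(ℝ, E)) p).target ↔ z.2 ∈ (extChartAt 𝓘(ℝ, E) p.2).target := by
  rw [extChartAt_prod]; simp [PartialEquiv.prod_target, chartAt_self_eq]

lemma mem_chartAt_cylinder_source (p q : ℝ × Y) :
    q ∈ (chartAt (ModelProd ℝ E) p).source ↔ q.2 ∈ (chartAt E p.2).source := by
  rw [prodChartedSpace_chartAt]; simp [chartAt_self_eq]

variable [IsManifold 𝓘(ℝ, E) ∞ Y]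

lemma mfderiv_extChartAt_cylinder_symm (p : ℝ × Y) {ρ : ℝ} {u : E}
    (hu : u ∈ (extChartAt 𝓘(ℝ, E) p.2).target) (a : ℝ) (v : E) :
    (mfderiv 𝓘(ℝ, ℝ × E) (𝓘(ℝ, ℝ).prod 𝓘(ℝ, E))
      (extChartAt (𝓘(ℝ, ℝ).prod 𝓘(ℝ, E)) p).symm (ρ, u) ((a, v) : ℝ × E) : ℝ × E) =
      (a, mfderiv 𝓘(ℝ, E) 𝓘(ℝ, E) (extChartAt 𝓘(ℝ, E) p.2).symm u v) := by
  have h1 : HasMFDerivAt 𝓘(ℝ, ℝ × E) 𝓘(ℝ, ℝ) (Prod.fst : ℝ × E → ℝ) (ρ, u)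
      (ContinuousLinearMap.fst ℝ ℝ E) := hasFDerivAt_fst.hasMFDerivAt
  have h2 : HasMFDerivAt 𝓘(ℝ, ℝ × E) 𝓘(ℝ, E) (Prod.snd : ℝ × E → E) (ρ, u)
      (ContinuousLinearMap.snd ℝ ℝ E) := hasFDerivAt_snd.hasMFDerivAt
  have h3 := (mdifferentiableAt_extChartAt_symm (I := 𝓘(ℝ, E)) hu).hasMFDerivAt
  have h4 := HasMFDerivAt.prodMk h1 (HasMFDerivAt.comp (ρ, u) h3 h2)
  have h5 := h4.mfderiv
  rw [extChartAt_cylinder_symm]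
  exact congrArg (fun T : ℝ × E →L[ℝ] ℝ × E => T (a, v)) h5

lemma chartForm_warpedForm (f : ℝ → ℝ) (h : ℝ → BilinField 𝓘(ℝ, E) Y) (p : ℝ × Y) {ρ : ℝ} {u : E}
    (hu : u ∈ (extChartAt 𝓘(ℝ, E) p.2).target) (a b : ℝ) (v w : E) :
    chartForm (warpedForm f h) p (ρ, u) (a, v) (b, w) =
      a * b + f ρ ^ 2 * chartForm (h ρ) p.2 u v w := by
  rw [chartForm]
  erw [mfderiv_extChartAt_cylinder_symm p hu, mfderiv_extChartAt_cylinder_symm p hu,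
    warpedForm_apply]
  rw [extChartAt_cylinder_symm]
  rfl

lemma chartBilin_warpedForm (f : ℝ → ℝ) (h : ℝ → BilinField 𝓘(ℝ, E) Y) (p : ℝ × Y) {ρ : ℝ} {u : E}
    (hu : u ∈ (extChartAt 𝓘(ℝ, E) p.2).target) (a b : ℝ) (v w : E) :
    chartBilin (warpedForm f h) p (ρ, u) (a, v) (b, w) =
      a * b + f ρ ^ 2 * chartBilin (h ρ) p.2 u v w :=
  chartForm_warpedForm f h p hu a b v w

/-- The square of the length of the `Y`-component of the velocity of the curve `y` at time `t`,
measured in the slice `{ρ} × Y`. -/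
def sliceSpeedSq (f : ℝ → ℝ) (h : ℝ → BilinField 𝓘(ℝ, E) Y) (y : ℝ → Y) (t ρ : ℝ) : ℝ :=
  f ρ ^ 2 * h ρ (y t) (velocity 𝓘(ℝ, E) y t) (velocity 𝓘(ℝ, E) y t)

/-- Joint smoothness in `(r, y)` is assumed for the whole metric only; evaluating it on vertical
vectors `(0, ẏ)` passes this smoothness on to the slice speed. -/
lemma sliceSpeedSq_eq_chartBilin (f : ℝ → ℝ) (h : ℝ → BilinField 𝓘(ℝ, E) Y) {y : ℝ → Y} {t : ℝ}
    (hy : MDifferentiableAt 𝓘(ℝ, ℝ) 𝓘(ℝ, E) y t) {p : ℝ × Y}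
    (hp : y t ∈ (chartAt E p.2).source) (ρ : ℝ) :
    sliceSpeedSq f h y t ρ = chartBilin (warpedForm f h) p (ρ, extChartAt 𝓘(ℝ, E) p.2 (y t))
      (0, deriv (fun s => extChartAt 𝓘(ℝ, E) p.2 (y s)) t)
      (0, deriv (fun s => extChartAt 𝓘(ℝ, E) p.2 (y s)) t) := by
  have hp' : y t ∈ (extChartAt 𝓘(ℝ, E) p.2).source := by rwa [extChartAt_source]
  rw [chartBilin_warpedForm f h p ((extChartAt 𝓘(ℝ, E) p.2).map_source hp'), sliceSpeedSq,
    form_velocity_eq_chartBilin (h ρ) hy hp]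
  ring

variable {f : ℝ → ℝ} {h : ℝ → BilinField 𝓘(ℝ, E) Y} {r : ℝ → ℝ} {y : ℝ → Y} {J : Set ℝ} {R : ℝ}

lemma isOpen_cylinder (R : ℝ) : IsOpen (cylinder R Y) := isOpen_Ioo.prod isOpen_univ

section Geodesic

variable {U : Set (ℝ × Y)}

lemma IsGeodesicOn.contDiffAt_fst
    (hγ : IsGeodesicOn (warpedForm f h) U (fun t => (r t, y t)) J) {t : ℝ} (ht : t ∈ J) :
    ContDiffAt ℝ 2 r t :=
  contMDiffAt_iff_contDiffAt.1 ((contMDiffAt_prod_iff _).1 (hγ.contMDiffAt ht)).1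

lemma IsGeodesicOn.contMDiffAt_snd
    (hγ : IsGeodesicOn (warpedForm f h) U (fun t => (r t, y t)) J) {t : ℝ} (ht : t ∈ J) :
    ContMDiffAt 𝓘(ℝ, ℝ) 𝓘(ℝ, E) 2 y t :=
  ((contMDiffAt_prod_iff _).1 (hγ.contMDiffAt ht)).2

lemma IsGeodesicOn.mdifferentiableAt_snd
    (hγ : IsGeodesicOn (warpedForm f h) U (fun t => (r t, y t)) J) {t : ℝ} (ht : t ∈ J) :
    MDifferentiableAt 𝓘(ℝ, ℝ) 𝓘(ℝ, E) y t :=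
  (hγ.contMDiffAt_snd ht).mdifferentiableAt (by norm_num)

lemma IsGeodesicOn.deriv_coord
    (hγ : IsGeodesicOn (warpedForm f h) U (fun t => (r t, y t)) J) {t : ℝ} (ht : t ∈ J)
    {p : ℝ × Y} (hp : y t ∈ (chartAt E p.2).source) :
    deriv (fun s => extChartAt (𝓘(ℝ, ℝ).prod 𝓘(ℝ, E)) p (r s, y s)) t =
      (deriv r t, deriv (fun s => extChartAt 𝓘(ℝ, E) p.2 (y s)) t) := by
  have h1 := ((hγ.contDiffAt_fst ht).differentiableAt (by norm_num)).hasDerivAt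
  have h2 := ((contDiffAt_extChartAt_comp (by norm_cast) (hγ.contMDiffAt_snd ht)
    hp).differentiableAt (by norm_num)).hasDerivAt
  rw [← (h1.prodMk h2).deriv]
  congr 1

/-- The geodesic equation in a product chart. -/
lemma IsGeodesicOn.hasDerivAt_coord
    (hγ : IsGeodesicOn (warpedForm f h) U (fun t => (r t, y t)) J) {t : ℝ} (ht : t ∈ J)
    {p : ℝ × Y} (hp : y t ∈ (chartAt E p.2).source) (b : ℝ) (w : E) :
    HasDerivAt (fun s => deriv r s * b + f (r s) ^ 2 * chartBilin (h (r s)) p.2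
        (extChartAt 𝓘(ℝ, E) p.2 (y s)) (deriv (fun s => extChartAt 𝓘(ℝ, E) p.2 (y s)) s) w)
      (1 / 2 * fderiv ℝ (fun z => chartBilin (warpedForm f h) p z
          (deriv r t, deriv (fun s => extChartAt 𝓘(ℝ, E) p.2 (y s)) t)
          (deriv r t, deriv (fun s => extChartAt 𝓘(ℝ, E) p.2 (y s)) t))
        (r t, extChartAt 𝓘(ℝ, E) p.2 (y t)) (b, w)) t := by
  have h1 := hγ.eulerLagrangeAt ht (p := p) ((mem_chartAt_cylinder_source p _).2 hp) (b, w)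
  rw [hγ.deriv_coord ht hp] at h1
  simp only [extChartAt_cylinder_apply p (r t, y t)] at h1
  refine h1.congr_of_eventuallyEq ?_
  filter_upwards [hγ.isOpen.mem_nhds ht, (hγ.contMDiffAt_snd ht).continuousAt.eventually
    ((chartAt E p.2).open_source.mem_nhds hp)] with s hs hs'
  have hs'' : y s ∈ (extChartAt 𝓘(ℝ, E) p.2).source := by rwa [extChartAt_source]
  rw [hγ.deriv_coord hs hs', extChartAt_cylinder_apply,
    chartBilin_warpedForm f h p ((extChartAt 𝓘(ℝ, E) p.2).map_source hs'')]

lemma IsUnitSpeedGeodesicOn.deriv_sq_add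
    (hγ : IsUnitSpeedGeodesicOn (warpedForm f h) U (fun t => (r t, y t)) J) {t : ℝ}
    (ht : t ∈ J) : deriv r t ^ 2 + sliceSpeedSq f h y t (r t) = 1 := by
  have hg := hγ.toIsGeodesicOn
  have hp := mem_chart_source E (y t)
  have hs : y t ∈ (extChartAt 𝓘(ℝ, E) (y t)).source := by rwa [extChartAt_source]
  have hu := (extChartAt 𝓘(ℝ, E) (y t)).map_source hs
  have h1 := hγ.chartBilin_deriv ht (p := (r t, y t)) ((mem_chartAt_cylinder_source _ _).2 hp)
  rw [hg.deriv_coord ht hp, extChartAt_cylinder_apply,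
    chartBilin_warpedForm f h (r t, y t) hu] at h1
  rw [sliceSpeedSq_eq_chartBilin f h (p := (r t, y t)) (hg.mdifferentiableAt_snd ht) hp,
    chartBilin_warpedForm f h (r t, y t) hu]
  linarith

variable (hg : IsRiemannianMetricOn (warpedForm f h) U) (hU : IsOpen U)
include hg hU

lemma IsGeodesicOn.coord_mem_chartDomain
    (hγ : IsGeodesicOn (warpedForm f h) U (fun t => (r t, y t)) J) {t : ℝ} (ht : t ∈ J)
    {p : ℝ × Y} (hp : y t ∈ (chartAt E p.2).source) :
    (r t, extChartAt 𝓘(ℝ, E) p.2 (y t)) ∈ chartDomain (𝓘(ℝ, ℝ).prod 𝓘(ℝ, E)) p U := by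
  rw [← extChartAt_cylinder_apply p (r t, y t)]
  exact extChartAt_mem_chartDomain ((mem_chartAt_cylinder_source p _).2 hp) (hγ.mapsTo ht)

lemma IsGeodesicOn.hasDerivAt_sliceSpeedSq
    (hγ : IsGeodesicOn (warpedForm f h) U (fun t => (r t, y t)) J) {t : ℝ} (ht : t ∈ J)
    {p : ℝ × Y} (hp : y t ∈ (chartAt E p.2).source) :
    HasDerivAt (sliceSpeedSq f h y t)
      (fderiv ℝ (chartBilin (warpedForm f h) p) (r t, extChartAt 𝓘(ℝ, E) p.2 (y t)) (1, 0)
        (0, deriv (fun s => extChartAt 𝓘(ℝ, E) p.2 (y s)) t)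
        (0, deriv (fun s => extChartAt 𝓘(ℝ, E) p.2 (y s)) t)) (r t) := by
  have hd := hg.differentiableAt_chartBilin hU (hγ.coord_mem_chartDomain hg hU ht hp)
  have h1 : HasDerivAt (fun ρ : ℝ => (ρ, extChartAt 𝓘(ℝ, E) p.2 (y t))) ((1, 0) : ℝ × E) (r t) :=
    (hasDerivAt_id _).prodMk (hasDerivAt_const _ _)
  have h2 := hd.hasFDerivAt.comp_hasDerivAt (r t) h1
  have h3 := (h2.clm_apply (hasDerivAt_const (r t)
    ((0, deriv (fun s => extChartAt 𝓘(ℝ, E) p.2 (y s)) t) : ℝ × E)))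
  have h4 := (h3.clm_apply (hasDerivAt_const (r t)
    ((0, deriv (fun s => extChartAt 𝓘(ℝ, E) p.2 (y s)) t) : ℝ × E)))
  simp only [map_zero, add_zero] at h4
  refine h4.congr_of_eventuallyEq (Eventually.of_forall fun ρ => ?_)
  exact sliceSpeedSq_eq_chartBilin f h (hγ.mdifferentiableAt_snd ht) hp ρ

/-- The radial component of the geodesic equation. -/
lemma IsGeodesicOn.hasDerivAt_deriv_fst
    (hγ : IsGeodesicOn (warpedForm f h) U (fun t => (r t, y t)) J) {t : ℝ} (ht : t ∈ J) :
    HasDerivAt (deriv r) (1 / 2 * deriv (sliceSpeedSq f h y t) (r t)) t := by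
  have hp := mem_chart_source E (y t)
  set p : ℝ × Y := (r t, y t) with hpdef
  have hD := hγ.coord_mem_chartDomain hg hU ht (p := p) hp
  have hd := hg.differentiableAt_chartBilin hU hD
  -- The test vector `(1, 0)` selects the radial momentum, which is `ṙ`.
  have h1 := hγ.hasDerivAt_coord ht (p := p) hp 1 0
  simp only [map_zero, mul_zero, add_zero, mul_one] at h1
  rw [(hγ.hasDerivAt_sliceSpeedSq hg hU ht (p := p) hp).deriv]
  convert h1 using 2
  rw [← fderiv_form_apply hd]
  -- Without cross terms the energy splits off the constant `ṙ²`; only the slice part depends on the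
  -- base point.
  have hev : (fun z => chartBilin (warpedForm f h) p z
      (deriv r t, deriv (fun s => extChartAt 𝓘(ℝ, E) p.2 (y s)) t)
      (deriv r t, deriv (fun s => extChartAt 𝓘(ℝ, E) p.2 (y s)) t)) =ᶠ[𝓝
        (r t, extChartAt 𝓘(ℝ, E) p.2 (y t))] fun z => deriv r t * deriv r t +
        chartBilin (warpedForm f h) p z (0, deriv (fun s => extChartAt 𝓘(ℝ, E) p.2 (y s)) t)
      (0, deriv (fun s => extChartAt 𝓘(ℝ, E) p.2 (y s)) t) := by
    filter_upwards [(isOpen_extChartAt_target p).mem_nhds hD.1] with z hz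
    have hz' := (mem_extChartAt_cylinder_target p z).1 hz
    obtain ⟨ρ, u⟩ := z
    rw [chartBilin_warpedForm f h p hz', chartBilin_warpedForm f h p hz']
    ring
  rw [hev.fderiv_eq, fderiv_const_add]

/-- The radial acceleration is locally bounded by the slice speed. -/
lemma IsGeodesicOn.eventually_abs_deriv_sliceSpeedSq_le
    (hγ : IsGeodesicOn (warpedForm f h) U (fun t => (r t, y t)) J) {t₀ : ℝ} (ht₀ : t₀ ∈ J) :
    ∃ C, 0 ≤ C ∧ ∀ᶠ t in 𝓝 t₀,
      |deriv (sliceSpeedSq f h y t) (r t)| ≤ C * sliceSpeedSq f h y t (r t) := by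
  have hp := mem_chart_source E (y t₀)
  set p : ℝ × Y := (r t₀, y t₀) with hpdef
  have hD := hγ.coord_mem_chartDomain hg hU ht₀ (p := p) hp
  have hDo := isOpen_chartDomain (I := 𝓘(ℝ, ℝ).prod 𝓘(ℝ, E)) p hU
  obtain ⟨ε, hε, hεD⟩ := Metric.nhds_basis_closedBall.mem_iff.1 (hDo.mem_nhds hD)
  have hC := hg.contDiffOn_chartBilin p
  obtain ⟨μ, hμ, hcoer⟩ := exists_coercive (isCompact_closedBall _ ε) (hC.continuousOn.mono hεD)
    (fun u hu v hv => hg.chartBilin_pos (hεD hu) hv)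
  obtain ⟨C, hCb⟩ := (isCompact_closedBall _ ε).exists_bound_of_continuousOn
    ((hC.continuousOn_fderiv_of_isOpen hDo (by simp)).mono hεD)
  have hC0 : 0 ≤ C := (norm_nonneg _).trans (hCb _ (Metric.mem_closedBall_self hε.le))
  -- `C` bounds the derivative of the metric coefficients by `C ‖v‖²`, and `μ ‖v‖²` is at most the
  -- slice speed.
  refine ⟨C / μ, by positivity, ?_⟩
  have hxc : ContinuousAt (fun t => (r t, extChartAt 𝓘(ℝ, E) p.2 (y t))) t₀ :=
    (hγ.contDiffAt_fst ht₀).continuousAt.prodMk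
      (contDiffAt_extChartAt_comp (by norm_cast) (hγ.contMDiffAt_snd ht₀) hp).continuousAt
  filter_upwards [hγ.isOpen.mem_nhds ht₀, (hγ.contMDiffAt_snd ht₀).continuousAt.eventually
    ((chartAt E p.2).open_source.mem_nhds hp),
    hxc.eventually (Metric.closedBall_mem_nhds _ hε)] with t ht hts htB
  rw [(hγ.hasDerivAt_sliceSpeedSq hg hU ht hts).deriv,
    sliceSpeedSq_eq_chartBilin f h (hγ.mdifferentiableAt_snd ht) hts]
  set v : ℝ × E := (0, deriv (fun s => extChartAt 𝓘(ℝ, E) p.2 (y s)) t)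
  set x := (r t, extChartAt 𝓘(ℝ, E) p.2 (y t))
  have h1 : |fderiv ℝ (chartBilin (warpedForm f h) p) x (1, 0) v v| ≤ C * ‖v‖ ^ 2 := by
    rw [← Real.norm_eq_abs]
    calc _ ≤ ‖fderiv ℝ (chartBilin (warpedForm f h) p) x (1, 0)‖ * ‖v‖ * ‖v‖ :=
          ContinuousLinearMap.le_opNorm₂ _ _ _
      _ ≤ C * 1 * ‖v‖ * ‖v‖ := by
          gcongr
          refine (ContinuousLinearMap.le_opNorm _ _).trans ?_
          gcongr
          · exact hCb _ htB
          · simp [Prod.norm_def]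
      _ = C * ‖v‖ ^ 2 := by ring
  calc _ ≤ C * ‖v‖ ^ 2 := h1
    _ = C / μ * (μ * ‖v‖ ^ 2) := by field_simp
    _ ≤ _ := by
      gcongr
      exact hcoer _ htB v

end Geodesic

end WarpedCharts

/-! ### One-variable analysis: a Gronwall argument and the radial profile. -/

section RealAnalysis

/-- A nonnegative function with `|q'| ≤ C q` near one of its zeros vanishes near this zero. -/
lemma eventually_eq_zero_of_abs_deriv_le {q q' : ℝ → ℝ} {t₀ C : ℝ}
    (hq : ∀ᶠ t in 𝓝 t₀, HasDerivAt q (q' t) t) (hq0 : ∀ᶠ t in 𝓝 t₀, 0 ≤ q t)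
    (hC : ∀ᶠ t in 𝓝 t₀, |q' t| ≤ C * q t) (h0 : q t₀ = 0) : ∀ᶠ t in 𝓝 t₀, q t = 0 := by
  obtain ⟨ε, hε, hball⟩ := Metric.eventually_nhds_iff_ball.1 (hq.and (hq0.and hC))
  have hconv : Convex ℝ (Metric.ball t₀ ε) := convex_ball t₀ ε
  -- Integrating factors: `q e^{Ct}` is nondecreasing and controls times before `t₀`, `q e^{-Ct}` is
  -- nonincreasing and controls times after `t₀`.
  have hd : ∀ K : ℝ, ∀ t ∈ Metric.ball t₀ ε,
      HasDerivAt (fun s => q s * Real.exp (K * s))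
        ((q' t + K * q t) * Real.exp (K * t)) t := by
    intro K t ht
    have h1 : HasDerivAt (fun s => Real.exp (K * s)) (Real.exp (K * t) * K) t := by
      simpa using ((hasDerivAt_id t).const_mul K).exp
    refine ((hball t ht).1.mul h1).congr_deriv ?_
    ring
  have hmono : MonotoneOn (fun s => q s * Real.exp (C * s)) (Metric.ball t₀ ε) := by
    refine monotoneOn_of_deriv_nonneg hconv
      (fun t ht => (hd C t ht).continuousAt.continuousWithinAt)
      (fun t ht => (hd C t (interior_subset ht)).differentiableAt.differentiableWithinAt) ?_
    intro t ht
    have ht' := interior_subset ht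
    rw [(hd C t ht').deriv]
    have := neg_le_of_abs_le (hball t ht').2.2
    exact mul_nonneg (by linarith) (Real.exp_pos _).le
  have hanti : AntitoneOn (fun s => q s * Real.exp (-C * s)) (Metric.ball t₀ ε) := by
    refine antitoneOn_of_deriv_nonpos hconv
      (fun t ht => (hd (-C) t ht).continuousAt.continuousWithinAt)
      (fun t ht => (hd (-C) t (interior_subset ht)).differentiableAt.differentiableWithinAt) ?_
    intro t ht
    have ht' := interior_subset ht
    rw [(hd (-C) t ht').deriv]
    have := le_of_abs_le (hball t ht').2.2
    exact mul_nonpos_of_nonpos_of_nonneg (by linarith) (Real.exp_pos _).le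
  have ht₀ := Metric.mem_ball_self (x := t₀) hε
  filter_upwards [Metric.ball_mem_nhds t₀ hε] with t ht
  refine le_antisymm ?_ (hball t ht).2.1
  rcases le_total t t₀ with hle | hle
  · have h1 := hmono ht ht₀ hle
    simp only [h0, zero_mul] at h1
    exact nonpos_of_mul_nonpos_left h1 (Real.exp_pos _)
  · have h1 := hanti ht₀ ht hle
    simp only [h0, zero_mul] at h1
    exact nonpos_of_mul_nonpos_left h1 (Real.exp_pos _)

/-- A property which is open and closed on a preconnected set propagates. -/
lemma IsPreconnected.forall_of_frequently {J : Set ℝ} (hJ : IsPreconnected J) {P : ℝ → Prop}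
    {t₀ : ℝ} (ht₀ : t₀ ∈ J) (h₀ : P t₀)
    (h : ∀ t ∈ J, (∃ᶠ s in 𝓝 t, P s) → ∀ᶠ s in 𝓝 t, P s) : ∀ t ∈ J, P t := by
  have hself : ∀ t, P t → ∃ᶠ s in 𝓝 t, P s := fun t ht hne => hne.self_of_nhds ht
  -- The set of points near which `P` holds is open by definition, and `h` makes it closed relative
  -- to `J`.
  have hsub : J ⊆ {t | ∀ᶠ s in 𝓝 t, P s} := by
    refine hJ.subset_of_closure_inter_subset isOpen_setOfPred_eventually_nhds
      ⟨t₀, ht₀, h t₀ ht₀ (hself t₀ h₀)⟩ ?_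
    rintro t ⟨htc, htJ⟩
    refine h t htJ ((mem_closure_iff_frequently.1 htc).mono fun s hs => ?_)
    exact Eventually.self_of_nhds hs
  exact fun t ht => (hsub ht).self_of_nhds

/-- The radial coordinate of a winding geodesic of a convex generalized warped product: `v` is the
radial velocity and `w` the radial acceleration. -/
structure IsRadialProfile (R c : ℝ) (r v w : ℝ → ℝ) (J : Set ℝ) : Prop where
  c_nonneg : 0 ≤ c
  small : R * c < 1
  mem : ∀ t ∈ J, r t ∈ Ioo 0 R
  hasDerivAt : ∀ t ∈ J, HasDerivAt r (v t) t
  hasDerivAt_v : ∀ t ∈ J, HasDerivAt v (w t) t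
  speed : ∀ t ∈ J, 0 < 1 - v t ^ 2
  acc : ∀ t ∈ J, (1 / r t - c) * (1 - v t ^ 2) ≤ w t

namespace IsRadialProfile

variable {R c : ℝ} {r v w : ℝ → ℝ} {J : Set ℝ}

/-- Only `v` changes sign and it enters the inequalities squared, so statements at the right end
transfer to the left end. -/
lemma comp_neg {a b : ℝ} (hp : IsRadialProfile R c r v w (Ioo a b)) :
    IsRadialProfile R c (fun t => r (-t)) (fun t => -v (-t)) (fun t => w (-t))
      (Ioo (-b) (-a)) := by
  have hm : ∀ t ∈ Ioo (-b) (-a), -t ∈ Ioo a b := fun t ht =>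
    ⟨by linarith [ht.2], by linarith [ht.1]⟩
  refine ⟨hp.c_nonneg, hp.small, fun t ht => hp.mem _ (hm t ht), fun t ht => ?_, fun t ht => ?_,
    fun t ht => by simpa using hp.speed _ (hm t ht), fun t ht => by
      simpa using hp.acc _ (hm t ht)⟩
  · exact ((hp.hasDerivAt _ (hm t ht)).comp t (hasDerivAt_neg t)).congr_deriv (by ring)
  · exact ((hp.hasDerivAt_v _ (hm t ht)).comp t (hasDerivAt_neg t)).neg.congr_deriv (by ring)

lemma mul_lt_one (hp : IsRadialProfile R c r v w J) {t : ℝ} (ht : t ∈ J) : r t * c < 1 :=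
  (mul_le_mul_of_nonneg_right (hp.mem t ht).2.le hp.c_nonneg).trans_lt hp.small

/-- Smallness of the radius means `1 / r > c`. -/
lemma acc_pos (hp : IsRadialProfile R c r v w J) {t : ℝ} (ht : t ∈ J) : 0 < w t := by
  refine lt_of_lt_of_le (mul_pos ?_ (hp.speed t ht)) (hp.acc t ht)
  rw [sub_pos, lt_div_iff₀ (hp.mem t ht).1, mul_comm]
  exact hp.mul_lt_one ht

lemma strictConvexOn (hp : IsRadialProfile R c r v w J) (hJ : IsOpen J) (hJc : Convex ℝ J) :
    StrictConvexOn ℝ J r := by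
  refine strictConvexOn_of_deriv2_pos hJc
    (fun t ht => (hp.hasDerivAt t ht).continuousAt.continuousWithinAt) fun t ht => ?_
  have ht' := interior_subset ht
  have hev : deriv r =ᶠ[𝓝 t] v := by
    filter_upwards [hJ.mem_nhds ht'] with s hs using (hp.hasDerivAt s hs).deriv
  simp only [Function.iterate_succ, Function.iterate_zero, Function.comp_apply, id]
  rw [hev.deriv_eq, (hp.hasDerivAt_v t ht').deriv]
  exact hp.acc_pos ht'

/-- `r v` takes values in `[-R, R]`, while its derivative `v² + r w ≥ v² + (1 - rc)(1 - v²)` is at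
least `1 - Rc`. -/
lemma length_le (hp : IsRadialProfile R c r v w J) (hJc : Convex ℝ J) {s t : ℝ} (hs : s ∈ J)
    (ht : t ∈ J) (hst : s ≤ t) : (1 - R * c) * (t - s) ≤ 2 * R := by
  have hd : ∀ x ∈ J, HasDerivAt (fun x => r x * v x) (v x * v x + r x * w x) x := fun x hx =>
    (hp.hasDerivAt x hx).mul (hp.hasDerivAt_v x hx)
  have h1 := hJc.mul_sub_le_image_sub_of_le_deriv (C := 1 - R * c)
    (fun x hx => (hd x hx).continuousAt.continuousWithinAt)
    (fun x hx => (hd x (interior_subset hx)).differentiableAt.differentiableWithinAt)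
    (fun x hx => by
      have hx' := interior_subset hx
      rw [(hd x hx').deriv]
      have hr := (hp.mem x hx').1
      have h2 : (1 - r x * c) * (1 - v x ^ 2) ≤ r x * w x := by
        have h3 := mul_le_mul_of_nonneg_left (hp.acc x hx') hr.le
        have h4 : r x * ((1 / r x - c) * (1 - v x ^ 2)) = (1 - r x * c) * (1 - v x ^ 2) := by
          field_simp
        linarith
      have h5 : r x * c ≤ R * c :=
        mul_le_mul_of_nonneg_right (hp.mem x hx').2.le hp.c_nonneg
      have h6 : 0 ≤ r x * c * v x ^ 2 :=
        mul_nonneg (mul_nonneg hr.le hp.c_nonneg) (sq_nonneg _)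
      nlinarith) s hs t ht hst
  have hb : ∀ x ∈ J, |r x * v x| ≤ R := by
    intro x hx
    have hv : |v x| ≤ 1 := by
      rw [← sq_le_one_iff_abs_le_one]
      linarith [hp.speed x hx]
    rw [abs_mul, abs_of_pos (hp.mem x hx).1]
    nlinarith [(hp.mem x hx).1, (hp.mem x hx).2, abs_nonneg (v x)]
  have h7 := le_of_abs_le (hb t ht)
  have h8 := neg_le_of_abs_le (hb s hs)
  linarith

/-- If the radial velocity is negative, the radius stays away from zero: the function
`(1 - v²) r² exp (-2 c r)` is nondecreasing. -/
lemma exists_lower_bound {a b : ℝ} (hp : IsRadialProfile R c r v w (Ioo a b))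
    (hv : ∀ t ∈ Ioo a b, v t < 0) {t₀ : ℝ} (ht₀ : t₀ ∈ Ioo a b) :
    ∃ α > 0, ∀ t ∈ Ico t₀ b, α ≤ r t := by
  -- The factor `r² exp(-2cr)` has logarithmic derivative `2v (1/r - c)`, which the inequality on
  -- `w` balances against that of `1 - v²` when `v < 0`.
  set E : ℝ → ℝ := fun t => (1 - v t ^ 2) * (r t ^ 2 * Real.exp (-2 * c * r t)) with hE
  have hd : ∀ t ∈ Ioo a b, HasDerivAt E
      (-2 * v t * r t ^ 2 * Real.exp (-2 * c * r t) *
        (w t - (1 / r t - c) * (1 - v t ^ 2))) t := by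
    intro t ht
    have hr := (hp.mem t ht).1.ne'
    have h1 := hp.hasDerivAt t ht
    have h2 := ((hp.hasDerivAt_v t ht).pow 2).const_sub 1
    have h3 := (h1.const_mul (-2 * c)).exp
    refine (h2.mul ((h1.pow 2).mul h3)).congr_deriv ?_
    simp only [Nat.cast_ofNat, Nat.add_one_sub_one, pow_one, Pi.mul_apply, Pi.pow_apply]
    field_simp
    ring
  have hmono : MonotoneOn E (Ioo a b) := by
    refine monotoneOn_of_deriv_nonneg (convex_Ioo a b)
      (fun t ht => (hd t ht).continuousAt.continuousWithinAt)
      (fun t ht => (hd t (interior_subset ht)).differentiableAt.differentiableWithinAt) ?_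
    intro t ht
    have ht' := interior_subset ht
    rw [(hd t ht').deriv]
    have h1 := hv t ht'
    have h2 := hp.acc t ht'
    refine mul_nonneg (mul_nonneg (mul_nonneg (by linarith) (sq_nonneg _)) (Real.exp_pos _).le) ?_
    linarith
  have hpos : 0 < E t₀ :=
    mul_pos (hp.speed t₀ ht₀) (mul_pos (pow_pos (hp.mem t₀ ht₀).1 2) (Real.exp_pos _))
  -- The other two factors are at most `1`, so `E t₀ ≤ E t ≤ r t ^ 2`.
  refine ⟨Real.sqrt (E t₀), Real.sqrt_pos.2 hpos, fun t ht => ?_⟩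
  have ht' : t ∈ Ioo a b := ⟨ht₀.1.trans_le ht.1, ht.2⟩
  have hr := (hp.mem t ht').1
  refine Real.sqrt_le_iff.2 ⟨hr.le, (hmono ht₀ ht' ht.1).trans ?_⟩
  have h1 : Real.exp (-2 * c * r t) ≤ 1 := by
    rw [Real.exp_le_one_iff]
    nlinarith [mul_nonneg hp.c_nonneg hr.le]
  have h2 : r t ^ 2 * Real.exp (-2 * c * r t) ≤ r t ^ 2 :=
    mul_le_of_le_one_right (sq_nonneg _) h1
  have h3 : 1 - v t ^ 2 ≤ 1 := by linarith [sq_nonneg (v t)]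
  exact (mul_le_of_le_one_left
    (mul_nonneg (sq_nonneg _) (Real.exp_pos _).le) h3).trans h2

/-- Either the radius tends to `R`, or it stays in a compact subset of `(0, R)`. -/
lemma tendsto_or_mem_Icc {a b : ℝ} (hp : IsRadialProfile R c r v w (Ioo a b)) (hab : a < b) :
    Tendsto r (𝓝[<] b) (𝓝 R) ∨
      ∃ α β, 0 < α ∧ β < R ∧ ∀ᶠ t in 𝓝[<] b, r t ∈ Icc α β := by
  have hcont : ∀ t ∈ Ioo a b, ContinuousAt r t := fun t ht => (hp.hasDerivAt t ht).continuousAt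
  -- As `v` is monotone, either `r` is eventually nondecreasing and converges to its supremum, or
  -- `r` decreases throughout and `exists_lower_bound` applies.
  by_cases hv : ∃ t₁ ∈ Ioo a b, 0 ≤ v t₁
  · obtain ⟨t₁, ht₁, hvt₁⟩ := hv
    have hvmono : MonotoneOn v (Ioo a b) := by
      refine monotoneOn_of_deriv_nonneg (convex_Ioo a b)
        (fun t ht => (hp.hasDerivAt_v t ht).continuousAt.continuousWithinAt)
        (fun t ht =>
          (hp.hasDerivAt_v t (interior_subset ht)).differentiableAt.differentiableWithinAt) ?_
      intro t ht
      rw [(hp.hasDerivAt_v t (interior_subset ht)).deriv]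
      exact (hp.acc_pos (interior_subset ht)).le
    have hsub : Ico t₁ b ⊆ Ioo a b := fun t ht => ⟨ht₁.1.trans_le ht.1, ht.2⟩
    have hrmono : MonotoneOn r (Ico t₁ b) := by
      refine monotoneOn_of_deriv_nonneg (convex_Ico t₁ b)
        (fun t ht => (hcont t (hsub ht)).continuousWithinAt)
        (fun t ht => (hp.hasDerivAt t
          (hsub (interior_subset ht))).differentiableAt.differentiableWithinAt) ?_
      intro t ht
      have ht' := interior_subset ht
      rw [(hp.hasDerivAt t (hsub ht')).deriv]
      exact hvt₁.trans (hvmono ht₁ (hsub ht') ht'.1)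
    have hbdd : BddAbove (r '' Ioo t₁ b) :=
      ⟨R, by rintro _ ⟨t, ht, rfl⟩; exact (hp.mem t (hsub ⟨ht.1.le, ht.2⟩)).2.le⟩
    have hne : (Ioo t₁ b).Nonempty := nonempty_Ioo.2 ht₁.2
    have hlim := (hrmono.mono Ioo_subset_Ico_self).tendsto_nhdsWithin_Ioo_left hne hbdd
    have hle : sSup (r '' Ioo t₁ b) ≤ R := by
      refine csSup_le (hne.image r) ?_
      rintro _ ⟨t, ht, rfl⟩
      exact (hp.mem t (hsub ⟨ht.1.le, ht.2⟩)).2.le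
    rcases hle.eq_or_lt with heq | hlt
    · left
      rwa [heq] at hlim
    · right
      refine ⟨r t₁, _, (hp.mem t₁ ht₁).1, hlt, ?_⟩
      filter_upwards [Ioo_mem_nhdsLT ht₁.2] with t ht
      exact ⟨hrmono ⟨le_rfl, ht₁.2⟩ ⟨ht.1.le, ht.2⟩ ht.1.le, le_csSup hbdd ⟨t, ht, rfl⟩⟩
  · right
    push Not at hv
    have ht₀ : (a + b) / 2 ∈ Ioo a b := ⟨by linarith, by linarith⟩
    obtain ⟨α, hα, hαr⟩ := hp.exists_lower_bound hv ht₀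
    have hranti : AntitoneOn r (Ioo a b) := by
      refine antitoneOn_of_deriv_nonpos (convex_Ioo a b)
        (fun t ht => (hcont t ht).continuousWithinAt)
        (fun t ht => (hp.hasDerivAt t
          (interior_subset ht)).differentiableAt.differentiableWithinAt) ?_
      intro t ht
      rw [(hp.hasDerivAt t (interior_subset ht)).deriv]
      exact (hv t (interior_subset ht)).le
    refine ⟨α, r ((a + b) / 2), hα, (hp.mem _ ht₀).2, ?_⟩
    filter_upwards [Ioo_mem_nhdsLT ht₀.2] with t ht
    exact ⟨hαr t ⟨ht.1.le, ht.2⟩, hranti ht₀ ⟨ht₀.1.trans ht.1, ht.2⟩ ht.1.le⟩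

end IsRadialProfile

lemma eq_Ioo_of_isOpen_ordConnected {J : Set ℝ} (hJ : IsOpen J) (hJc : J.OrdConnected)
    (hne : J.Nonempty) {L : ℝ} (hL : ∀ s ∈ J, ∀ t ∈ J, s ≤ t → t - s ≤ L) :
    ∃ a b, a < b ∧ J = Ioo a b := by
  obtain ⟨t₀, ht₀⟩ := hne
  have hL0 := hL t₀ ht₀ t₀ ht₀ le_rfl
  have habove : BddAbove J := ⟨t₀ + L, fun t ht => by
    rcases le_total t₀ t with h | h
    · linarith [hL t₀ ht₀ t ht h]
    · linarith⟩
  have hbelow : BddBelow J := ⟨t₀ - L, fun t ht => by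
    rcases le_total t₀ t with h | h
    · linarith
    · linarith [hL t ht t₀ ht₀ h]⟩
  have hsub : J ⊆ Ioo (sInf J) (sSup J) := by
    intro t ht
    obtain ⟨ε, hε, hball⟩ := Metric.isOpen_iff.1 hJ t ht
    have h1 : t + ε / 2 ∈ J := hball (by
      rw [Metric.mem_ball, Real.dist_eq, abs_of_pos (by linarith)]; linarith)
    have h2 : t - ε / 2 ∈ J := hball (by
      rw [Metric.mem_ball, Real.dist_eq, abs_of_neg (by linarith)]; linarith)
    exact ⟨by linarith [csInf_le hbelow h2], by linarith [le_csSup habove h1]⟩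
  refine ⟨sInf J, sSup J, (hsub ht₀).1.trans (hsub ht₀).2, hsub.antisymm ?_⟩
  exact IsConnected.Ioo_csInf_csSup_subset ⟨⟨t₀, ht₀⟩, hJc.isPreconnected⟩ hbelow habove

end RealAnalysis

/-! ### Time reversal, maximality, and curves of zero velocity. -/

section Reversal

variable {F : Type*} [NormedAddCommGroup F] [NormedSpace ℝ F] [FiniteDimensional ℝ F]
  {H : Type*} [TopologicalSpace H] {I : ModelWithCorners ℝ F H} [I.Boundaryless]
  {M : Type*} [TopologicalSpace M] [ChartedSpace H M] [IsManifold I ∞ M]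

/-- The energy is even in the velocity: the momentum and the time derivative both change sign. -/
lemma EulerLagrangeAt.comp_neg {G : F → F →L[ℝ] F →L[ℝ] ℝ} {x : ℝ → F} {t : ℝ}
    (h : EulerLagrangeAt G x (-t)) : EulerLagrangeAt G (fun s => x (-s)) t := by
  intro w
  have h1 := ((h w).comp t (hasDerivAt_neg t)).neg
  refine (h1.congr_deriv ?_).congr_of_eventuallyEq (Eventually.of_forall fun s => ?_)
  · simp [deriv_comp_neg]
  · simp [deriv_comp_neg]

lemma IsGeodesicOn.comp_neg {g : BilinField I M} {U : Set M} {γ : ℝ → M} {a b : ℝ}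
    (h : IsGeodesicOn g U γ (Ioo a b)) :
    IsGeodesicOn g U (fun t => γ (-t)) (Ioo (-b) (-a)) := by
  have hm : ∀ t ∈ Ioo (-b) (-a), -t ∈ Ioo a b := fun t ht =>
    ⟨by linarith [ht.2], by linarith [ht.1]⟩
  obtain ⟨t₀, ht₀⟩ := h.nonempty
  refine ⟨isOpen_Ioo, ordConnected_Ioo, ⟨-t₀, by linarith [ht₀.2], by linarith [ht₀.1]⟩, ?_,
    fun t ht => h.mapsTo (hm t ht), ?_⟩
  · have h1 : ContMDiffOn 𝓘(ℝ, ℝ) 𝓘(ℝ, ℝ) 2 (fun t : ℝ => -t) (Ioo (-b) (-a)) :=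
      contDiff_neg.contMDiff.contMDiffOn
    exact h.contMDiffOn.comp h1 hm
  · intro p t ht hp w
    exact EulerLagrangeAt.comp_neg (x := fun s => extChartAt I p (γ s))
      (h.eulerLagrangeAt (hm t ht) hp) w

lemma IsUnitSpeedGeodesicOn.comp_neg {g : BilinField I M} {U : Set M} {γ : ℝ → M} {a b : ℝ}
    (h : IsUnitSpeedGeodesicOn g U γ (Ioo a b)) :
    IsUnitSpeedGeodesicOn g U (fun t => γ (-t)) (Ioo (-b) (-a)) := by
  have hg := h.toIsGeodesicOn.comp_neg
  refine ⟨hg, fun t ht => ?_⟩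
  have hm : -t ∈ Ioo a b := ⟨by linarith [ht.2], by linarith [ht.1]⟩
  have hp := mem_chart_source H (γ (-t))
  rw [form_velocity_eq_chartBilin g ((hg.contMDiffAt ht).mdifferentiableAt (by norm_num)) hp,
    deriv_comp_neg (f := fun s => extChartAt I (γ (-t)) (γ s)), map_neg, map_neg, neg_apply,
    neg_neg]
  exact h.chartBilin_deriv hm hp

/-- A maximal unit speed geodesic on `(a, b)` does not stay in a compact set near `b`. -/
lemma IsUnitSpeedGeodesicOn.not_eventually_mem_right [T2Space M] {g : BilinField I M} {U : Set M}
    (hU : IsOpen U) (hg : IsRiemannianMetricOn g U) {γ : ℝ → M} {a b : ℝ} (hab : a < b)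
    (hγ : IsUnitSpeedGeodesicOn g U γ (Ioo a b)) (hmax : IsMaximalGeodesicOn g U γ (Ioo a b))
    {K : Set M} (hK : IsCompact K) (hKU : K ⊆ U) : ¬ ∀ᶠ t in 𝓝[<] b, γ t ∈ K := by
  intro hev
  obtain ⟨b', hb', γ', hγ', heq⟩ := hγ.exists_extension hU hg hab hK hKU hev
  have h1 := hmax.2 γ' _ hγ' (Ioo_subset_Ioo_right hb'.le) heq
  have h2 : b ∈ Ioo a b' := ⟨hab, hb'⟩
  rw [h1] at h2
  exact lt_irrefl _ h2.2

/-- A maximal unit speed geodesic on `(a, b)` does not stay in a compact set near `a`. -/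
lemma IsUnitSpeedGeodesicOn.not_eventually_mem_left [T2Space M] {g : BilinField I M} {U : Set M}
    (hU : IsOpen U) (hg : IsRiemannianMetricOn g U) {γ : ℝ → M} {a b : ℝ} (hab : a < b)
    (hγ : IsUnitSpeedGeodesicOn g U γ (Ioo a b)) (hmax : IsMaximalGeodesicOn g U γ (Ioo a b))
    {K : Set M} (hK : IsCompact K) (hKU : K ⊆ U) : ¬ ∀ᶠ t in 𝓝[>] a, γ t ∈ K := by
  intro hev
  have hev' : ∀ᶠ t in 𝓝[<] (-a), γ (-t) ∈ K := by
    have : Tendsto (fun t : ℝ => -t) (𝓝[<] (-a)) (𝓝[>] a) := by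
      simpa using tendsto_neg_nhdsLT (a := -a)
    exact this.eventually hev
  obtain ⟨b', hb', γ', hγ', heq⟩ := hγ.comp_neg.exists_extension hU hg (neg_lt_neg hab) hK hKU hev'
  have h3 := hγ'.comp_neg
  rw [neg_neg] at h3
  have h1 := hmax.2 _ _ h3 (Ioo_subset_Ioo_left (by linarith)) fun t ht => by
    have := heq (x := -t) ⟨by linarith [ht.2], by linarith [ht.1]⟩
    simpa using this
  have h2 : a ∈ Ioo (-b') b := ⟨by linarith, hab⟩
  rw [h1] at h2
  exact lt_irrefl _ h2.1

/-- A curve with vanishing velocity on a preconnected set is constant. -/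
lemma exists_eq_of_velocity_eq_zero {γ : ℝ → M} {J : Set ℝ} (hJ : IsOpen J)
    (hJc : IsPreconnected J) (hγ : ∀ t ∈ J, MDifferentiableAt 𝓘(ℝ, ℝ) I γ t)
    (h0 : ∀ t ∈ J, velocity I γ t = 0) : ∃ q, ∀ t ∈ J, γ t = q := by
  have : IsManifold I 1 M := IsManifold.of_le (n := ∞) (by norm_cast)
  rcases J.eq_empty_or_nonempty with rfl | ⟨t₀, ht₀⟩
  · exact ⟨γ 0, by simp⟩
  have hloc : ∀ t ∈ J, ∀ᶠ s in 𝓝 t, γ s = γ t := by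
    intro t ht
    have hp := mem_chart_source H (γ t)
    have hev : ∀ᶠ s in 𝓝 t, s ∈ J ∧ γ s ∈ (chartAt H (γ t)).source :=
      (hJ.eventually_mem ht).and
        ((hγ t ht).continuousAt.eventually ((chartAt H (γ t)).open_source.mem_nhds hp))
    obtain ⟨ε, hε, hball⟩ := Metric.eventually_nhds_iff_ball.1 hev
    have hd : ∀ s ∈ Metric.ball t ε,
        HasDerivAt (fun s => extChartAt I (γ t) (γ s)) 0 s := by
      intro s hs
      obtain ⟨hsJ, hss⟩ := hball s hs
      have h1 : MDifferentiableAt 𝓘(ℝ, ℝ) 𝓘(ℝ, F) (fun s => extChartAt I (γ t) (γ s)) s :=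
        (mdifferentiableAt_extChartAt hss).comp s (hγ s hsJ)
      have h2 := h1.differentiableAt.hasDerivAt
      have hs' : γ s ∈ (extChartAt I (γ t)).source := by rwa [extChartAt_source]
      have h3 := mfderiv_extChartAt_symm_injective ((extChartAt I (γ t)).map_source hs')
        (((velocity_eq_mfderiv_symm (hγ s hsJ) hss).symm.trans (h0 s hsJ)).trans
          (map_zero _).symm)
      exact h2.congr_deriv h3
    filter_upwards [Metric.ball_mem_nhds t hε] with s hs
    have h4 := (convex_ball t ε).is_const_of_fderivWithin_eq_zero (𝕜 := ℝ)
      (fun s hs => (hd s hs).differentiableAt.differentiableWithinAt)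
      (fun s hs => by
        rw [fderivWithin_of_isOpen Metric.isOpen_ball hs, (hd s hs).hasFDerivAt.fderiv]; simp)
      hs (Metric.mem_ball_self hε)
    have hst : γ s ∈ (extChartAt I (γ t)).source := by
      rw [extChartAt_source]; exact (hball s hs).2
    exact (extChartAt I (γ t)).injOn hst (mem_extChartAt_source (γ t)) h4
  refine ⟨γ t₀, hJc.forall_of_frequently (P := fun t => γ t = γ t₀) ht₀ rfl fun t ht hf => ?_⟩
  obtain ⟨s, hs, hs'⟩ := (hf.and_eventually (hloc t ht)).exists
  filter_upwards [hloc t ht] with s' h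
  rw [h, ← hs', hs]

end Reversal

/-! ### Geodesics are radial or winding. -/

section Trichotomy

variable {E : Type*} [NormedAddCommGroup E] [NormedSpace ℝ E] [FiniteDimensional ℝ E]
  {Y : Type*} [TopologicalSpace Y] [ChartedSpace E Y]

lemma IsRiemannianMetricOn.mono {F : Type*} [NormedAddCommGroup F] [NormedSpace ℝ F]
    {H : Type*} [TopologicalSpace H] {I : ModelWithCorners ℝ F H}
    {M : Type*} [TopologicalSpace M] [ChartedSpace H M] {g : BilinField I M} {U V : Set M}
    (hg : IsRiemannianMetricOn g U) (hV : V ⊆ U) : IsRiemannianMetricOn g V :=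
  ⟨fun p hp => hg.symm p (hV hp), fun p hp => hg.pos p (hV hp), fun p v w =>
    (hg.smooth p v w).mono (inter_subset_inter_right _ (preimage_mono hV))⟩

variable {f : ℝ → ℝ} {h : ℝ → BilinField 𝓘(ℝ, E) Y} {r : ℝ → ℝ} {y : ℝ → Y} {J : Set ℝ} {R : ℝ}

lemma IsGenWarpedProduct.sliceSpeedSq_pos (hg : IsGenWarpedProduct R f h) {t ρ : ℝ}
    (hρ : ρ ∈ Ioo 0 R) (hv : velocity 𝓘(ℝ, E) y t ≠ 0) : 0 < sliceSpeedSq f h y t ρ :=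
  mul_pos (pow_pos (hg.f_pos ρ hρ) 2) ((hg.h_metric ρ hρ).pos _ (mem_univ _) _ hv)

lemma IsGenWarpedProduct.sliceSpeedSq_nonneg (hg : IsGenWarpedProduct R f h) {t ρ : ℝ}
    (hρ : ρ ∈ Ioo 0 R) : 0 ≤ sliceSpeedSq f h y t ρ := by
  by_cases hv : velocity 𝓘(ℝ, E) y t = 0
  · simp [sliceSpeedSq, hv]
  · exact (hg.sliceSpeedSq_pos hρ hv).le

variable [IsManifold 𝓘(ℝ, E) ∞ Y]

/-- If `ẏ` vanishes somewhere then it vanishes everywhere. -/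
lemma IsGenWarpedProduct.velocity_eq_zero (hg : IsGenWarpedProduct R f h)
    (hγ : IsUnitSpeedGeodesicOn (warpedForm f h) (cylinder R Y) (fun t => (r t, y t)) J)
    {t₀ : ℝ} (ht₀ : t₀ ∈ J) (h0 : velocity 𝓘(ℝ, E) y t₀ = 0) :
    ∀ t ∈ J, velocity 𝓘(ℝ, E) y t = 0 := by
  have hgeo := hγ.toIsGeodesicOn
  have hmem : ∀ t ∈ J, r t ∈ Ioo 0 R := fun t ht => (hgeo.mapsTo ht).1
  have hacc := fun t ht => hgeo.hasDerivAt_deriv_fst (t := t) hg.metric (isOpen_cylinder R) ht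
  have hq : ∀ t ∈ J, sliceSpeedSq f h y t (r t) = 1 - deriv r t ^ 2 := fun t ht => by
    linarith [hγ.deriv_sq_add ht]
  have hev : ∀ t ∈ J, ∀ᶠ s in 𝓝 t, s ∈ J := fun t ht => hgeo.isOpen.mem_nhds ht
  have hqd : ∀ t ∈ J, HasDerivAt (fun s => 1 - deriv r s ^ 2)
      (-(deriv r t * deriv (sliceSpeedSq f h y t) (r t))) t := fun t ht => by
    refine (((hacc t ht).pow 2).const_sub 1).congr_deriv ?_
    ring
  -- Continuity makes the zero set closed; the estimate `|q'| ≤ C q` for `q = 1 - ṙ²`, valid because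
  -- `|ṙ| ≤ 1`, makes it open.
  have key : ∀ t ∈ J, 1 - deriv r t ^ 2 = 0 := by
    refine hgeo.ordConnected.isPreconnected.forall_of_frequently ht₀ ?_ ?_
    · rw [← hq t₀ ht₀]; simp [sliceSpeedSq, h0]
    · intro t ht hfreq
      obtain ⟨C, -, hC⟩ :=
        hgeo.eventually_abs_deriv_sliceSpeedSq_le hg.metric (isOpen_cylinder R) ht
      have hzero : 1 - deriv r t ^ 2 = 0 := by
        by_contra hne
        exact hfreq ((hqd t ht).continuousAt.eventually_ne hne)
      refine eventually_eq_zero_of_abs_deriv_le (C := C)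
        (q' := fun t => -(deriv r t * deriv (sliceSpeedSq f h y t) (r t)))
        ((hev t ht).mono fun s hs => hqd s hs) ((hev t ht).mono fun s hs => ?_) ?_ hzero
      · rw [← hq s hs]; exact hg.sliceSpeedSq_nonneg (hmem s hs)
      · filter_upwards [hev t ht, hC] with s hs hsC
        rw [hq s hs] at hsC
        have h1 : |deriv r s| ≤ 1 := by
          rw [← sq_le_one_iff_abs_le_one]
          linarith [hg.sliceSpeedSq_nonneg (y := y) (t := s) (hmem s hs), hq s hs]
        rw [abs_neg, abs_mul]
        exact (mul_le_of_le_one_left (abs_nonneg _) h1).trans hsC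
  intro t ht
  by_contra hv
  have h1 := hg.sliceSpeedSq_pos (hmem t ht) hv
  rw [hq t ht, key t ht] at h1
  exact lt_irrefl _ h1

/-- Every unit speed geodesic is radial or winding. -/
theorem IsGenWarpedProduct.isRadial_or_isWinding (hg : IsGenWarpedProduct R f h)
    (hγ : IsUnitSpeedGeodesicOn (warpedForm f h) (cylinder R Y) (fun t => (r t, y t)) J) :
    IsRadial r y J ∨ IsWinding E y J := by
  by_cases hw : IsWinding E y J
  · exact Or.inr hw
  left
  rw [IsWinding] at hw
  push Not at hw
  obtain ⟨t₀, ht₀, h0⟩ := hw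
  have hgeo := hγ.toIsGeodesicOn
  have hzero := hg.velocity_eq_zero hγ ht₀ h0
  have hJc := hgeo.ordConnected.isPreconnected
  refine ⟨exists_eq_of_velocity_eq_zero hgeo.isOpen hJc
    (fun t ht => hgeo.mdifferentiableAt_snd ht) hzero, ?_⟩
  have hsq : ∀ t ∈ J, deriv r t ^ 2 = 1 := fun t ht => by
    have := hγ.deriv_sq_add ht
    simpa [sliceSpeedSq, hzero t ht] using this
  have hcont : ContinuousOn (deriv r) J := fun t ht =>
    (hgeo.hasDerivAt_deriv_fst hg.metric (isOpen_cylinder R) ht).continuousAt.continuousWithinAt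
  rcases hJc.eq_or_eq_neg_of_sq_eq (g := fun _ => (1 : ℝ)) hcont continuousOn_const
    (fun t ht => by simpa using hsq t ht) (fun _ => by simp) with h1 | h1
  · exact Or.inl fun t ht => h1 ht
  · exact Or.inr fun t ht => by simpa using h1 ht

end Trichotomy

/-! ### Maximal winding geodesics for convex warping functions. -/

section Winding

variable {E : Type*} [NormedAddCommGroup E] [NormedSpace ℝ E] [FiniteDimensional ℝ E]
  {Y : Type*} [TopologicalSpace Y] [ChartedSpace E Y]
  {f : ℝ → ℝ} {h : ℝ → BilinField 𝓘(ℝ, E) Y} {r : ℝ → ℝ} {y : ℝ → Y} {J : Set ℝ} {R : ℝ}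

/-- By convexity the chord from `(0, 0)` is no steeper than the tangent at its right end. -/
lemma IsConvexWarping.div_le_deriv (hf : IsConvexWarping R f) {ρ : ℝ} (hρ : ρ ∈ Ioo 0 R) :
    f ρ / ρ ≤ deriv f ρ := by
  have hd : DifferentiableAt ℝ f ρ :=
    ((hf.contDiffOn.mono Ioo_subset_Ico_self).contDiffAt
      (isOpen_Ioo.mem_nhds hρ)).differentiableAt (by norm_num)
  have h1 := hf.convex.slope_le_of_hasDerivAt ⟨le_rfl, hρ.1.trans hρ.2⟩ ⟨hρ.1.le, hρ.2⟩ hρ.1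
    hd.hasDerivAt
  rwa [slope_def_field, hf.zero, sub_zero, sub_zero] at h1

/-- `½ (f² h)' = f f' h + ½ f² h'`: the first term is at least `(1/ρ) f² h`, the second at least `-c
f² h`. -/
lemma IsGenWarpedProduct.le_deriv_sliceSpeedSq (hg : IsGenWarpedProduct R f h)
    (hf : IsConvexWarping R f) {c : ℝ} (hc : HasRadialDerivBound R h c) {t ρ : ℝ}
    (hρ : ρ ∈ Ioo 0 R) :
    (1 / ρ - c) * sliceSpeedSq f h y t ρ ≤ 1 / 2 * deriv (sliceSpeedSq f h y t) ρ := by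
  set v := velocity 𝓘(ℝ, E) y t with hv
  have hfd : HasDerivAt f (deriv f ρ) ρ :=
    ((hg.f_contDiffOn.contDiffAt (isOpen_Ioo.mem_nhds hρ)).differentiableAt
      (by norm_num)).hasDerivAt
  have hhd : HasDerivAt (fun s => h s (y t) v v) (deriv (fun s => h s (y t) v v) ρ) ρ :=
    (((hg.h_contDiffOn (y t) v v).contDiffAt (isOpen_Ioo.mem_nhds hρ)).differentiableAt
      (by norm_num)).hasDerivAt
  have hS : HasDerivAt (sliceSpeedSq f h y t) _ ρ := (hfd.pow 2).mul hhd
  rw [hS.deriv]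
  have h1 := hf.div_le_deriv hρ
  have h2 := neg_le_of_abs_le (hc.2 ρ hρ (y t) v)
  have hfp := hg.f_pos ρ hρ
  have h3 : 0 ≤ h ρ (y t) v v := by
    by_cases hv0 : v = 0
    · simp [hv0]
    · exact ((hg.h_metric ρ hρ).pos _ (mem_univ _) _ hv0).le
  have h4 := mul_le_mul_of_nonneg_right h1 (mul_nonneg hfp.le h3)
  have h5 := mul_le_mul_of_nonneg_left h2 (sq_nonneg (f ρ))
  have h6 : f ρ / ρ * (f ρ * h ρ (y t) v v) = 1 / ρ * (f ρ ^ 2 * h ρ (y t) v v) := by ring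
  simp only [sliceSpeedSq, Nat.cast_ofNat, Nat.add_one_sub_one, pow_one, Pi.pow_apply]
  rw [← hv]
  linarith

variable [IsManifold 𝓘(ℝ, E) ∞ Y]

/-- Passes from geometry to one-variable analysis: unit speed turns the slice speed into `1 - ṙ²`,
and the radial equation turns its derivative into `r̈`. -/
lemma IsGenWarpedProduct.isRadialProfile (hg : IsGenWarpedProduct R f h)
    (hf : IsConvexWarping R f) {c : ℝ} (hc : HasRadialDerivBound R h c) {R' : ℝ} (hR' : R' ≤ R)
    (hRc : R' * c < 1)
    (hγ : IsUnitSpeedGeodesicOn (warpedForm f h) (cylinder R' Y) (fun t => (r t, y t)) J)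
    (hw : IsWinding E y J) : IsRadialProfile R' c r (deriv r) (deriv (deriv r)) J := by
  have hgeo := hγ.toIsGeodesicOn
  have hmem : ∀ t ∈ J, r t ∈ Ioo 0 R' := fun t ht => (hgeo.mapsTo ht).1
  have hmem' : ∀ t ∈ J, r t ∈ Ioo 0 R := fun t ht => ⟨(hmem t ht).1, (hmem t ht).2.trans_le hR'⟩
  have hacc := fun t ht => hgeo.hasDerivAt_deriv_fst (t := t)
    (hg.metric.mono (prod_mono (Ioo_subset_Ioo_right hR') le_rfl)) (isOpen_cylinder R') ht
  have hq : ∀ t ∈ J, 1 - deriv r t ^ 2 = sliceSpeedSq f h y t (r t) := fun t ht => by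
    linarith [hγ.deriv_sq_add ht]
  refine ⟨hc.1, hRc, hmem, fun t ht =>
    ((hgeo.contDiffAt_fst ht).differentiableAt (by norm_num)).hasDerivAt,
    fun t ht => (hacc t ht).differentiableAt.hasDerivAt, fun t ht => ?_, fun t ht => ?_⟩
  · rw [hq t ht]
    exact hg.sliceSpeedSq_pos (hmem' t ht) (hw t ht)
  · rw [hq t ht, (hacc t ht).deriv]
    exact hg.le_deriv_sliceSpeedSq hf hc (hmem' t ht)

/-- Maximal winding geodesics near the tip of a convex generalized warped product have strictly
convex radius and finite length, and enter and leave at `r = R'`. -/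
theorem IsGenWarpedProduct.maximal_winding [CompactSpace Y] [T2Space Y]
    (hg : IsGenWarpedProduct R f h)
    (hf : IsConvexWarping R f) {c : ℝ} (hc : HasRadialDerivBound R h c) {R' : ℝ} (hR' : R' ≤ R)
    (hRc : R' * c < 1)
    (hγ : IsUnitSpeedGeodesicOn (warpedForm f h) (cylinder R' Y) (fun t => (r t, y t)) J)
    (hmax : IsMaximalGeodesicOn (warpedForm f h) (cylinder R' Y) (fun t => (r t, y t)) J)
    (hw : IsWinding E y J) :
    StrictConvexOn ℝ J r ∧ ∃ Tm Tp : ℝ, Tm < Tp ∧ J = Ioo Tm Tp ∧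
      Tendsto r (𝓝[>] Tm) (𝓝 R') ∧ Tendsto r (𝓝[<] Tp) (𝓝 R') := by
  have hp := hg.isRadialProfile hf hc hR' hRc hγ hw
  have hgeo := hγ.toIsGeodesicOn
  have hJc : Convex ℝ J := hgeo.ordConnected.convex
  refine ⟨hp.strictConvexOn hgeo.isOpen hJc, ?_⟩
  have hδ : 0 < 1 - R' * c := by linarith
  obtain ⟨a, b, hab, rfl⟩ := eq_Ioo_of_isOpen_ordConnected (L := 2 * R' / (1 - R' * c))
    hgeo.isOpen hgeo.ordConnected hgeo.nonempty (fun s hs t ht hst => by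
      rw [le_div_iff₀ hδ, mul_comm]
      exact hp.length_le hJc hs ht hst)
  have hg' := hg.metric.mono (prod_mono (Ioo_subset_Ioo_right hR') le_rfl :
    cylinder R' Y ⊆ cylinder R Y)
  -- Compactness of `Y` makes confinement of `r` alone confine the whole curve.
  have hK : ∀ α β : ℝ, IsCompact (Icc α β ×ˢ (univ : Set Y)) := fun α β =>
    isCompact_Icc.prod isCompact_univ
  have hKU : ∀ α β : ℝ, 0 < α → β < R' → Icc α β ×ˢ (univ : Set Y) ⊆ cylinder R' Y :=
    fun α β hα hβ => prod_mono (fun t ht => ⟨hα.trans_le ht.1, ht.2.trans_lt hβ⟩) le_rfl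
  refine ⟨a, b, hab, rfl, ?_, ?_⟩
  · rcases hp.comp_neg.tendsto_or_mem_Icc (neg_lt_neg hab) with hlim | ⟨α, β, hα, hβ, hev⟩
    · have h1 : Tendsto (fun t : ℝ => -t) (𝓝[>] a) (𝓝[<] (-a)) := tendsto_neg_nhdsGT
      simpa [Function.comp_def] using hlim.comp h1
    · refine absurd ?_ (hγ.not_eventually_mem_left (isOpen_cylinder R') hg' hab hmax (hK α β)
        (hKU α β hα hβ))
      have h1 : Tendsto (fun t : ℝ => -t) (𝓝[>] a) (𝓝[<] (-a)) := tendsto_neg_nhdsGT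
      filter_upwards [h1.eventually hev] with t ht
      rw [neg_neg] at ht
      exact ⟨ht, mem_univ _⟩
  · rcases hp.tendsto_or_mem_Icc hab with hlim | ⟨α, β, hα, hβ, hev⟩
    · exact hlim
    · exact absurd (hev.mono fun t ht => ⟨ht, mem_univ _⟩)
        (hγ.not_eventually_mem_right (isOpen_cylinder R') hg' hab hmax (hK α β)
          (hKU α β hα hβ))

end Winding

/-! ### Warped products: projection to geodesics of the cross section. -/

section Reparametrization

/-- A positive `C¹` function `m` on an open interval `J` has a `C²` primitive, which is a
diffeomorphism onto an open interval with `C²` inverse. -/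
lemma exists_reparametrization {J : Set ℝ} (hJ : IsOpen J) (hJc : J.OrdConnected)
    (hne : J.Nonempty) {m : ℝ → ℝ} (hm : ContDiffOn ℝ 1 m J) (hpos : ∀ t ∈ J, 0 < m t) :
    ∃ σ τ : ℝ → ℝ, ContDiffOn ℝ 2 σ J ∧ (∀ t ∈ J, HasDerivAt σ (m t) t) ∧ IsOpen (σ '' J) ∧
      (σ '' J).OrdConnected ∧ (∀ t ∈ J, τ (σ t) = t) ∧
      (∀ s ∈ σ '' J, HasDerivAt τ (m (τ s))⁻¹ s) ∧ ContDiffOn ℝ 2 τ (σ '' J) := by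
  obtain ⟨t₀, ht₀⟩ := hne
  set σ : ℝ → ℝ := fun t => ∫ s in t₀..t, m s with hσ
  have hmc : ContinuousOn m J := hm.continuousOn
  have hσd : ∀ t ∈ J, HasDerivAt σ (m t) t := fun t ht =>
    intervalIntegral.integral_hasDerivAt_right
      ((hmc.mono (hJc.uIcc_subset ht₀ ht)).intervalIntegrable)
      (hmc.stronglyMeasurableAtFilter hJ t ht) (hmc.continuousAt (hJ.mem_nhds ht))
  have hσc : ContinuousOn σ J := fun t ht => (hσd t ht).continuousAt.continuousWithinAt
  have hσmono : StrictMonoOn σ J := by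
    refine strictMonoOn_of_deriv_pos hJc.convex hσc fun t ht => ?_
    rw [(hσd t (interior_subset ht)).deriv]
    exact hpos t (interior_subset ht)
  have hσ2 : ContDiffOn ℝ 2 σ J := by
    rw [show (2 : ℕ∞ω) = 1 + 1 by norm_num, contDiffOn_succ_iff_deriv_of_isOpen hJ]
    exact ⟨fun t ht => (hσd t ht).differentiableAt.differentiableWithinAt, by simp,
      hm.congr fun t ht => (hσd t ht).deriv⟩
  have hIc : (σ '' J).OrdConnected := (hJc.isPreconnected.image σ hσc).ordConnected
  have hnear : ∀ t ∈ J, ∃ a ∈ J, ∃ b ∈ J, a < t ∧ t < b := by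
    intro t ht
    obtain ⟨ε, hε, hball⟩ := Metric.isOpen_iff.1 hJ t ht
    refine ⟨t - ε / 2, hball ?_, t + ε / 2, hball ?_, by linarith, by linarith⟩ <;>
      rw [Metric.mem_ball, Real.dist_eq, abs_lt] <;> constructor <;> linarith
  have hIo : IsOpen (σ '' J) := by
    rw [isOpen_iff_mem_nhds]
    rintro _ ⟨t, ht, rfl⟩
    obtain ⟨a, ha, b, hb, hat, htb⟩ := hnear t ht
    exact mem_of_superset (Icc_mem_nhds (hσmono ha ht hat) (hσmono ht hb htb))
      (hIc.out (mem_image_of_mem σ ha) (mem_image_of_mem σ hb))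
  set τ : ℝ → ℝ := Function.invFunOn σ J with hτ
  have hτσ : ∀ t ∈ J, τ (σ t) = t := fun t ht => hσmono.injOn.leftInvOn_invFunOn ht
  have hστ : ∀ s ∈ σ '' J, σ (τ s) = s := by
    rintro _ ⟨t, ht, rfl⟩
    rw [hτσ t ht]
  have hτmem : ∀ s ∈ σ '' J, τ s ∈ J := by
    rintro _ ⟨t, ht, rfl⟩
    rwa [hτσ t ht]
  have hτmono : StrictMonoOn τ (σ '' J) := by
    intro s hs s' hs' hss'
    rw [← hσmono.lt_iff_lt (hτmem s hs) (hτmem s' hs'), hστ s hs, hστ s' hs']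
    exact hss'
  have hτim : τ '' (σ '' J) = J := by
    rw [image_image]
    exact (image_congr hτσ).trans (image_id' J)
  have hτc : ∀ s ∈ σ '' J, ContinuousAt τ s := fun s hs =>
    hτmono.continuousAt_of_image_mem_nhds (hIo.mem_nhds hs)
      (by rw [hτim]; exact hJ.mem_nhds (hτmem s hs))
  have hτd : ∀ s ∈ σ '' J, HasDerivAt τ (m (τ s))⁻¹ s := fun s hs =>
    HasDerivAt.of_local_left_inverse (hτc s hs) (hσd _ (hτmem s hs)) (hpos _ (hτmem s hs)).ne'
      ((hIo.eventually_mem hs).mono hστ)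
  have hτdiff : DifferentiableOn ℝ τ (σ '' J) := fun s hs =>
    (hτd s hs).differentiableAt.differentiableWithinAt
  -- Bootstrapping through `τ' = 1 / (m ∘ τ)`: continuity of `τ` gives `C¹`, which gives `C²`.
  have hminv : ContDiffOn ℝ 1 (fun t => (m t)⁻¹) J := hm.inv fun t ht => (hpos t ht).ne'
  have hτ1 : ContDiffOn ℝ 1 τ (σ '' J) := by
    rw [show (1 : ℕ∞ω) = 0 + 1 by norm_num, contDiffOn_succ_iff_deriv_of_isOpen hIo]
    refine ⟨hτdiff, by simp, contDiffOn_zero.2 ?_⟩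
    exact (hminv.continuousOn.comp hτdiff.continuousOn hτmem).congr fun s hs => (hτd s hs).deriv
  have hτ2 : ContDiffOn ℝ 2 τ (σ '' J) := by
    rw [show (2 : ℕ∞ω) = 1 + 1 by norm_num, contDiffOn_succ_iff_deriv_of_isOpen hIo]
    exact ⟨hτdiff, by simp, (hminv.comp hτ1 hτmem).congr fun s hs => (hτd s hs).deriv⟩
  exact ⟨σ, τ, hσ2, hσd, hIo, hIc, hτσ, hτd, hτ2⟩

/-- A solution of the Euler-Lagrange equation weighted by a function `φ` becomes a solution of the
unweighted one after reparametrization with `τ' = φ`. -/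
lemma EulerLagrangeAt.of_weighted {F : Type*} [NormedAddCommGroup F] [NormedSpace ℝ F]
    {G : F → F →L[ℝ] F →L[ℝ] ℝ} {x : ℝ → F} {φ τ : ℝ → ℝ} {s : ℝ}
    (hG : DifferentiableAt ℝ G (x (τ s)))
    (hτ : ∀ᶠ s' in 𝓝 s, HasDerivAt τ (φ (τ s')) s')
    (hx : ∀ᶠ s' in 𝓝 s, DifferentiableAt ℝ x (τ s'))
    (hE : ∀ w, HasDerivAt (fun t => φ t * G (x t) (deriv x t) w)
      (1 / 2 * (φ (τ s) * fderiv ℝ (fun u => G u (deriv x (τ s)) (deriv x (τ s))) (x (τ s)) w))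
      (τ s)) :
    EulerLagrangeAt G (fun s' => x (τ s')) s := by
  have hd : ∀ᶠ s' in 𝓝 s, deriv (fun s' => x (τ s')) s' = φ (τ s') • deriv x (τ s') := by
    filter_upwards [hτ, hx] with s' h1 h2
    exact (h2.hasDerivAt.scomp s' h1).deriv
  intro w
  have h1 := (hE w).comp s hτ.self_of_nhds
  refine (h1.congr_deriv ?_).congr_of_eventuallyEq ?_
  -- One factor `φ` is the weight and the other is `τ'`; together they scale both velocities in the
  -- quadratic right side. On the left the weight is the velocity factor.
  · rw [hd.self_of_nhds, fderiv_form_apply hG, fderiv_form_apply hG]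
    simp only [map_smul, smul_apply, smul_eq_mul]
    ring
  · filter_upwards [hd] with s' h2
    rw [h2]
    simp

variable {E : Type*} [NormedAddCommGroup E] [NormedSpace ℝ E] [FiniteDimensional ℝ E]
  {Y : Type*} [TopologicalSpace Y] [ChartedSpace E Y] [IsManifold 𝓘(ℝ, E) ∞ Y]
  {f : ℝ → ℝ} {h : ℝ → BilinField 𝓘(ℝ, E) Y} {r : ℝ → ℝ} {y : ℝ → Y} {J : Set ℝ} {R : ℝ}

/-- The `Y`-component of the geodesic equation of a warped product. -/
lemma IsGenWarpedProduct.hasDerivAt_snd (hg : IsGenWarpedProduct R f h)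
    {k : BilinField 𝓘(ℝ, E) Y} (hk : ∀ r ∈ Ioo 0 R, h r = k)
    (hγ : IsGeodesicOn (warpedForm f h) (cylinder R Y) (fun t => (r t, y t)) J)
    {t : ℝ} (ht : t ∈ J) {q : Y} (hq : y t ∈ (chartAt E q).source) (w : E) :
    HasDerivAt (fun s => f (r s) ^ 2 * chartBilin k q (extChartAt 𝓘(ℝ, E) q (y s))
        (deriv (fun s => extChartAt 𝓘(ℝ, E) q (y s)) s) w)
      (1 / 2 * (f (r t) ^ 2 * fderiv ℝ (fun u => chartBilin k q u
        (deriv (fun s => extChartAt 𝓘(ℝ, E) q (y s)) t)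
        (deriv (fun s => extChartAt 𝓘(ℝ, E) q (y s)) t)) (extChartAt 𝓘(ℝ, E) q (y t)) w)) t := by
  have hmem : ∀ s ∈ J, r s ∈ Ioo 0 R := fun s hs => (hγ.mapsTo hs).1
  have hD := hγ.coord_mem_chartDomain hg.metric (isOpen_cylinder R) ht (p := ((0 : ℝ), q)) hq
  have hd := hg.metric.differentiableAt_chartBilin (isOpen_cylinder R) hD
  have hut := (mem_extChartAt_cylinder_target ((0 : ℝ), q) _).1 hD.1
  -- Vertical test vector `(0, w)`. The first coordinate of the chart centre is immaterial, since
  -- the chart of `ℝ` is the identity.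
  have h1 := hγ.hasDerivAt_coord ht (p := ((0 : ℝ), q)) hq 0 w
  refine (h1.congr_of_eventuallyEq ?_).congr_deriv ?_
  · filter_upwards [hγ.isOpen.mem_nhds ht] with s hs
    rw [hk _ (hmem s hs)]
    ring
  · set v := deriv (fun s => extChartAt 𝓘(ℝ, E) q (y s)) t
    set u₀ := extChartAt 𝓘(ℝ, E) q (y t)
    congr 1
    have hk0 : IsRiemannianMetricOn k univ := hk _ (hmem t ht) ▸ hg.h_metric _ (hmem t ht)
    have hkd : DifferentiableAt ℝ (chartBilin k q) u₀ :=
      hk0.differentiableAt_chartBilin isOpen_univ ⟨hut, mem_univ _⟩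
    have hline : HasFDerivAt (fun u : E => ((r t, u) : ℝ × E)) (ContinuousLinearMap.inr ℝ ℝ E) u₀ :=
      hasFDerivAt_prodMk_right (r t) u₀
    have hd' : DifferentiableAt ℝ (fun z => chartBilin (warpedForm f h) ((0 : ℝ), q) z
        (deriv r t, v) (deriv r t, v)) (r t, u₀) :=
      (hd.clm_apply (differentiableAt_const _)).clm_apply (differentiableAt_const _)
    have h2 := HasFDerivAt.comp u₀ hd'.hasFDerivAt hline
    have h3 := congrArg (fun T : E →L[ℝ] ℝ => T w) h2.fderiv
    have hev : (fun u => chartBilin (warpedForm f h) ((0 : ℝ), q) (r t, u)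
        (deriv r t, v) (deriv r t, v)) =ᶠ[𝓝 u₀]
        fun u => deriv r t * deriv r t + f (r t) ^ 2 * chartBilin k q u v v := by
      filter_upwards [(isOpen_extChartAt_target q).mem_nhds hut] with u hu
      rw [chartBilin_warpedForm f h ((0 : ℝ), q) hu, hk _ (hmem t ht)]
    have hkvv : DifferentiableAt ℝ (fun u => chartBilin k q u v v) u₀ :=
      (hkd.clm_apply (differentiableAt_const v)).clm_apply (differentiableAt_const v)
    have h4 := (hev.fderiv_eq.trans (fderiv_const_add _)).trans (fderiv_const_mul hkvv _)
    exact h3.symm.trans (congrArg (fun T : E →L[ℝ] ℝ => T w) h4)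

/-- In a warped product, geodesics project to reparametrized geodesics of the cross section. -/
theorem IsGenWarpedProduct.isReparametrizedGeodesic (hg : IsGenWarpedProduct R f h)
    {k : BilinField 𝓘(ℝ, E) Y} (hk : ∀ r ∈ Ioo 0 R, h r = k)
    (hγ : IsGeodesicOn (warpedForm f h) (cylinder R Y) (fun t => (r t, y t)) J) :
    IsReparametrizedGeodesic k y J := by
  have hmem : ∀ t ∈ J, r t ∈ Ioo 0 R := fun t ht => (hγ.mapsTo ht).1
  have hfpos : ∀ t ∈ J, 0 < f (r t) ^ 2 := fun t ht => pow_pos (hg.f_pos _ (hmem t ht)) 2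
  have hfC : ContDiffOn ℝ 1 (fun t => f (r t) ^ 2) J :=
    (hg.f_contDiffOn.comp
      (fun t ht => ((hγ.contDiffAt_fst ht).of_le (by norm_cast)).contDiffWithinAt) hmem).pow 2
  -- With `σ' = f(r)⁻²` the inverse satisfies `τ' = f(r ∘ τ)²`, which is the weight in the
  -- `Y`-equation.
  obtain ⟨σ, τ, hσ2, hσd, hIo, hIc, hτσ, hτd, hτ2⟩ := exists_reparametrization hγ.isOpen
    hγ.ordConnected hγ.nonempty (hfC.inv fun t ht => (hfpos t ht).ne')
    (fun t ht => inv_pos.2 (hfpos t ht))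
  have hτmem : ∀ s ∈ σ '' J, τ s ∈ J := by
    rintro _ ⟨t, ht, rfl⟩
    rwa [hτσ t ht]
  refine ⟨σ, fun s => y (τ s), hσ2, fun t ht => ?_, ⟨hIo, hIc, hγ.nonempty.image σ, ?_,
    fun _ _ => mem_univ _, ?_⟩, fun t ht => by simp only [hτσ t ht]⟩
  · rw [(hσd t ht).deriv]
    exact inv_pos.2 (hfpos t ht)
  · intro s hs
    exact ((hγ.contMDiffAt_snd (hτmem s hs)).comp s
      (contMDiffAt_iff_contDiffAt.2 (hτ2.contDiffAt (hIo.mem_nhds hs)))).contMDiffWithinAt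
  · intro q s hs hq
    have ht := hτmem s hs
    have hk0 : IsRiemannianMetricOn k univ := hk _ (hmem _ ht) ▸ hg.h_metric _ (hmem _ ht)
    have hτc : ContinuousAt τ s := (hτd s hs).continuousAt
    refine EulerLagrangeAt.of_weighted (G := chartBilin k q)
      (x := fun t => extChartAt 𝓘(ℝ, E) q (y t)) (φ := fun t => f (r t) ^ 2) (τ := τ)
      (hk0.differentiableAt_chartBilin isOpen_univ
        (extChartAt_mem_chartDomain hq (mem_univ _))) ?_ ?_
      (hg.hasDerivAt_snd hk hγ ht hq)
    · filter_upwards [hIo.mem_nhds hs] with s' hs'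
      simpa using hτd s' hs'
    · filter_upwards [hIo.mem_nhds hs, hτc.eventually
        ((hγ.contMDiffAt_snd ht).continuousAt.eventually
          ((chartAt E q).open_source.mem_nhds hq))] with s' hs' hq'
      exact (contDiffAt_extChartAt_comp (by norm_cast) (hγ.contMDiffAt_snd (hτmem s' hs'))
        hq').differentiableAt (by norm_num)

end Reparametrization

end

theorem theoremA {E : Type*} [NormedAddCommGroup E] [NormedSpace ℝ E] [FiniteDimensional ℝ E]
    {Y : Type*} [TopologicalSpace Y] [ChartedSpace E Y] [IsManifold 𝓘(ℝ, E) ∞ Y]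
    [CompactSpace Y] [T2Space Y]
    (R : ℝ) (f : ℝ → ℝ) (h : ℝ → BilinField 𝓘(ℝ, E) Y)
    (hg : IsGenWarpedProduct R f h) :
    -- every geodesic is radial or winding
    (∀ (r : ℝ → ℝ) (y : ℝ → Y) (J : Set ℝ),
      IsUnitSpeedGeodesicOn (warpedForm f h) (cylinder R Y) (fun t => (r t, y t)) J →
        IsRadial r y J ∨ IsWinding E y J) ∧
    -- maximal winding geodesics, for convex `f` with `f 0 = 0` and small radius `R'`
    (IsConvexWarping R f → ∀ c : ℝ, HasRadialDerivBound R h c →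
      ∀ R' : ℝ, 0 < R' → R' ≤ R → R' * c < 1 →
        ∀ (r : ℝ → ℝ) (y : ℝ → Y) (J : Set ℝ),
          IsUnitSpeedGeodesicOn (warpedForm f h) (cylinder R' Y) (fun t => (r t, y t)) J →
          IsMaximalGeodesicOn (warpedForm f h) (cylinder R' Y) (fun t => (r t, y t)) J →
          IsWinding E y J →
            StrictConvexOn ℝ J r ∧
            ∃ Tm Tp : ℝ, Tm < Tp ∧ J = Ioo Tm Tp ∧
              Tendsto r (𝓝[>] Tm) (𝓝 R') ∧ Tendsto r (𝓝[<] Tp) (𝓝 R')) ∧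
    -- the warped product case
    (∀ k : BilinField 𝓘(ℝ, E) Y, (∀ r ∈ Ioo 0 R, h r = k) →
      ∀ (r : ℝ → ℝ) (y : ℝ → Y) (J : Set ℝ),
        IsUnitSpeedGeodesicOn (warpedForm f h) (cylinder R Y) (fun t => (r t, y t)) J →
          IsReparametrizedGeodesic k y J) :=
  ⟨fun _ _ _ hγ => hg.isRadial_or_isWinding hγ,
    fun hf _ hc _ _ hR' hRc _ _ _ hγ hmax hw => hg.maximal_winding hf hc hR' hRc hγ hmax hw,
    fun _ hk _ _ _ hγ => hg.isReparametrizedGeodesic hk hγ.toIsGeodesicOn⟩
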